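/- Let $N\ge 2$, $\eta_{\alpha\beta}=\delta_{\alpha+\beta,N+1}$ and $(\eta^{\alpha\beta})=(\eta_{\alpha\beta})^{-1}$ (repeated indices are summed). A solution of the WDVV equations on an open set $U\subset\mathbb C^N$ is an analytic function $F$ on $U$ with $\partial_1\partial_\alpha\partial_\beta F=\eta_{\alpha\beta}$ such that $c^\alpha_{\beta\gamma}=\eta^{\alpha\nu}\partial_\nu\partial_\beta\partial_\gamma F$ satisfies $c_{\alpha\beta}^\lambda c_{\lambda\gamma}^\nu=c_{\gamma\beta}^\lambda c_{\lambda\alpha}^\nu$. It is conformal with charge $d\in\mathbb C$ and spectrum $\mu_1=-\frac d2,\mu_2,\dots,\mu_N\in\mathbb C$ if, for $E=\sum_\alpha(1-\frac d2-\mu_\alpha)v^\alpha\partial_\alpha$, one has $E(F)=(3-d)F+\frac12A_{\alpha\beta}v^\alpha v^\beta+B_\alpha v^\alpha+C$ with constants $A_{\alpha\beta},B_\alpha,C$. Its Hamiltonian structures are $$P_1^{\alpha\beta}=\eta^{\alpha\beta}\partial_x,\qquad P_2^{\alpha\beta}=\Big(\sum_\gamma(1-\tfrac d2-\mu_\gamma)v^\gamma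 c^{\alpha\beta}_\gamma\Big)\partial_x+\big(\tfrac12-\mu_\beta\big)c^{\alpha\beta}_\gamma v^\gamma_x ,\qquad c^{\alpha\beta}_\gamma=\eta^{\alpha\nu}c^\beta_{\nu\gamma}.$$ Let $F$ be a conformal solution, with charge $d$ and spectrum $(\mu_\alpha)$, on a nonempty open set $U$. On $V=\{v\in U: v^N\neq0\}$ let $$\hat v^1=\frac{\eta_{\alpha\beta}v^\alpha v^\beta}{2v^N},\quad \hat v^i=\frac{v^i}{v^N}\ (1<i<N),\quad \hat v^N=-\frac1{v^N},\qquad \hat F(\hat v)=(v^N)^{-2}\Big(F(v)-\tfrac12\eta_{\alpha\beta}v^1v^\alpha v^\beta\Big),$$ and suppose that $\hat F$ is a solution of the WDVV equations, with the same $\eta$, on the image $\hat V$ of $V$. Put $\hat d=2-d$, $\hat\mu_1=\mu_N-1$, $\hat\mu_N=\mu_1+1$, $\hat\mu_i=\mu_i$ $(1<i<N)$, and let $\hat P_1,\hat P_2$ be the operators above formed with $\hat F,\hat d,\hat\mu_\alpha$, the dependent variables $\hat v$ and the independent variable $\hat x$. Let $\Phi$ be the action on operators of the reciprocal transformation $d\hat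 x=v^N\,dx+\cdots$ (the coefficient of $dx=dt^{1,0}$ in $d\hat x=\sum\theta_{\alpha,p}(v)\,dt^{\alpha,p}$ is $\theta_{1,0}=\eta_{1\beta}v^\beta=v^N$) together with $v\mapsto\hat v$, that is, $\Phi(P)=L\circ P\circ L^*$, where, with $\rho=v^N$, $$L^\alpha_\beta=\frac{\partial\hat v^\alpha}{\partial v^\beta}-\frac{\hat v^\alpha_x}{\rho}\,\partial_x^{-1}\circ\frac{\partial\rho}{\partial v^\beta},\qquad (L^*)^\alpha_\beta=\rho\,\frac{\partial\hat v^\alpha}{\partial v^\beta}+\frac{\partial\rho}{\partial v^\beta}\,\partial_x^{-1}\circ\hat v^\alpha_x ,$$ are the linearization of the map $v(x)\mapsto\hat v(\hat x)$ and its adjoint; the compositions are taken in the algebra of formal pseudo-differential operators in $\partial_x$ whose coefficients are functions on the jets of curves $x\mapsto v(x)$. Then $\hat F$ is conformal on $\hat V$ with charge $\hat d$ and spectrum $(\hat\mu_\alpha)$, and on all jets of curves in $V$ $$\Phi(P_1)=\hat P_1,\qquad \Phi(P_2)=\hat P_2\qquad\Big(\partial_{\hat x}=\frac1{v^N}\,\partial_x\Big).$$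 In particular, the a priori nonlocal operators $\Phi(P_1)$ and $\Phi(P_2)$ are local, i.e. differential operators. -/

import Mathlib

noncomputable section

namespace WDVV

/-! ### Solutions of the WDVV equations

The number of variables is `n + 2`, i.e. at least two (the assumption `η₁₁ = 0` together with
`det η ≠ 0` excludes one variable).  The index `1` of the mathematical notation is `0 : Fin (n + 2)`,
and the last index is `Fin.last (n + 1)`. -/

/-- Points `(v¹, …, vᴺ)`, `N = n + 2`. -/
abbrev Pt (n : ℕ) := Fin (n + 2) → ℂ

/-- The partial derivative `∂f / ∂v^α`. -/
def pd {n : ℕ} (α : Fin (n + 2)) (f : Pt n → ℂ) : Pt n → ℂ :=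
  fun v => fderiv ℂ f v (Pi.single α 1)

/-- The normalized metric: `η_{αβ} = 1` if `α + β = N + 1` (one-based indices), and `0` otherwise. -/
def eta {n : ℕ} (α β : Fin (n + 2)) : ℂ := if β = Fin.rev α then 1 else 0

/-- The normalized metric is its own inverse, so that `η^{αβ} = η_{αβ}`. -/
theorem eta_mul_eta (n : ℕ) :
    (Matrix.of (eta (n := n)) * Matrix.of (eta (n := n)) :
      Matrix (Fin (n + 2)) (Fin (n + 2)) ℂ) = 1 := by
  ext α β
  rw [Matrix.mul_apply, Finset.sum_eq_single (Fin.rev α)]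
  · simp [eta, Matrix.one_apply, eq_comm]
  · intro γ _ hγ
    simp [eta, hγ]
  · simp

/-- `c_{αβγ} = ∂³F / ∂v^α ∂v^β ∂v^γ`. -/
def cLow {n : ℕ} (F : Pt n → ℂ) (α β γ : Fin (n + 2)) : Pt n → ℂ := pd α (pd β (pd γ F))

/-- `c^α_{βγ} = η^{αν} c_{νβγ}`. -/
def cMid {n : ℕ} (F : Pt n → ℂ) (α β γ : Fin (n + 2)) : Pt n → ℂ :=
  fun v => ∑ ν, eta α ν * cLow F ν β γ v

/-- `c^{αβ}_γ = η^{αν} c^β_{νγ}`. -/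
def cUp {n : ℕ} (F : Pt n → ℂ) (α β γ : Fin (n + 2)) : Pt n → ℂ :=
  fun v => ∑ ν, eta α ν * cMid F β ν γ v

/-- `F` is an analytic solution, on the open set `U`, of the WDVV equations with the normalized
metric `η`. -/
structure IsSolution {n : ℕ} (F : Pt n → ℂ) (U : Set (Pt n)) : Prop where
  isOpen : IsOpen U
  analytic : AnalyticOnNhd ℂ F U
  metric : ∀ v ∈ U, ∀ α β, cLow F 0 α β v = eta α β
  assoc : ∀ v ∈ U, ∀ α β γ ν,
    ∑ l, cMid F l α β v * cMid F ν l γ v = ∑ l, cMid F l γ β v * cMid F ν l α v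

/-- `F` is conformal on `U` with charge `d` and spectrum `μ`: for the Euler vector field
`E = ∑ (1 - d/2 - μ_α) v^α ∂_α`, `μ_1 = -d/2`, one has
`E(F) = (3 - d) F + ½ A_{αβ} v^α v^β + B_α v^α + C` with constants `A`, `B`, `C`. -/
def IsConformal {n : ℕ} (F : Pt n → ℂ) (U : Set (Pt n)) (d : ℂ) (μ : Fin (n + 2) → ℂ) : Prop :=
  μ 0 = -d / 2 ∧
    ∃ (A : Fin (n + 2) → Fin (n + 2) → ℂ) (B : Fin (n + 2) → ℂ) (C : ℂ), ∀ v ∈ U,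
      ∑ α, (1 - d / 2 - μ α) * v α * pd α F v =
        (3 - d) * F v + 1 / 2 * ∑ α, ∑ β, A α β * v α * v β + ∑ α, B α * v α + C

/-! ### The inversion symmetry -/

/-- The quadratic form `η_{αβ} v^α v^β`. -/
def etaQuad {n : ℕ} (v : Pt n) : ℂ := ∑ α, ∑ β, eta α β * v α * v β

/-- The inversion `v ↦ v̂` (used where the last coordinate does not vanish):
`v̂¹ = ½ η_{αβ} v^α v^β / v^N`, `v̂^i = v^i / v^N` for `1 < i < N`, `v̂^N = -1 / v^N`. -/
def inv {n : ℕ} (v : Pt n) : Pt n := fun α =>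
  if α = 0 then 1 / 2 * etaQuad v / v (Fin.last (n + 1))
  else if α = Fin.last (n + 1) then -1 / v (Fin.last (n + 1))
  else v α / v (Fin.last (n + 1))

/-- The part of `U` on which the inversion is defined. -/
def regular {n : ℕ} (U : Set (Pt n)) : Set (Pt n) := {v ∈ U | v (Fin.last (n + 1)) ≠ 0}

/-- `Fh`, on the image of `U` under the inversion, is the inversion of `F`:
`F̂(v̂) = (v^N)⁻² (F(v) - ½ η_{αβ} v¹ v^α v^β)`. -/
def IsInversion {n : ℕ} (F Fh : Pt n → ℂ) (U : Set (Pt n)) : Prop :=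
  ∀ v ∈ regular U,
    Fh (inv v) = (F v - 1 / 2 * v 0 * etaQuad v) / v (Fin.last (n + 1)) ^ 2

/-- The charge `d̂ = 2 - d` of the inverted solution. -/
def chargeInv (d : ℂ) : ℂ := 2 - d

/-- The spectrum of the inverted solution: `μ̂_1 = μ_N - 1`, `μ̂_N = μ_1 + 1`, and `μ̂_i = μ_i`
for the other indices. -/
def spectrumInv {n : ℕ} (μ : Fin (n + 2) → ℂ) : Fin (n + 2) → ℂ := fun α =>
  if α = 0 then μ (Fin.last (n + 1)) - 1
  else if α = Fin.last (n + 1) then μ 0 + 1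
  else μ α

/-! ### Differential functions and formal pseudo-differential operators -/

/-- Jets of curves `x ↦ v(x)`: `u k α` stands for the `k`-th `x`-derivative of `v^α`. -/
abbrev Jet (n : ℕ) := ℕ → Pt n

/-- Functions of the jet variables `v, v_x, v_xx, …`. -/
abbrev DiffFun (n : ℕ) := Jet n → ℂ

/-- A function of `v`, seen as a function on jets. -/
def ofPt {n : ℕ} (f : Pt n → ℂ) : DiffFun n := fun u => f (u 0)

/-- The total derivative `∂_x f = ∑_{k, α} v^{α, k + 1} ∂f / ∂v^{α, k}`, i.e. the derivative of
`f` at `u` along the shifted jet `(u 1, u 2, …)`. -/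
def Dx {n : ℕ} (f : DiffFun n) : DiffFun n :=
  fun u => lineDeriv ℂ f u (fun k => u (k + 1))

theorem Dx_zero {n : ℕ} : Dx (0 : DiffFun n) = 0 := by
  funext u
  simp [Dx, lineDeriv]

theorem Dx_iterate_zero {n : ℕ} (k : ℕ) : Dx^[k] (0 : DiffFun n) = 0 := by
  induction k with
  | zero => rfl
  | succ k ih => rw [Function.iterate_succ_apply, Dx_zero, ih]

/-- Formal pseudo-differential operators `∑_{k ≤ K} a_k ∂_x^k`, `k ∈ ℤ`, whose coefficients are
functions on jets: families of coefficients that vanish for all large `k`. -/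
def PsiDO (n : ℕ) : AddSubgroup (ℤ → DiffFun n) where
  carrier := {a | ∃ K : ℤ, ∀ k, K < k → a k = 0}
  zero_mem' := ⟨0, fun _ _ => rfl⟩
  add_mem' := by
    rintro a b ⟨K, hK⟩ ⟨L, hL⟩
    refine ⟨max K L, fun k hk => ?_⟩
    simp [hK k (lt_of_le_of_lt (le_max_left _ _) hk), hL k (lt_of_le_of_lt (le_max_right _ _) hk)]
  neg_mem' := by
    rintro a ⟨K, hK⟩
    exact ⟨K, fun k hk => by simp [hK k hk]⟩

/-- The operator `f ∂_x^k`. -/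
def mono {n : ℕ} (f : DiffFun n) (k : ℤ) : PsiDO n :=
  ⟨Pi.single k f, k, fun _ hj => Pi.single_eq_of_ne (M := fun _ : ℤ => DiffFun n) (ne_of_gt hj) f⟩

/-- Composition of formal pseudo-differential operators, given by
`a ∂_x^i ∘ b ∂_x^j = ∑_{k ≥ 0} (i choose k) a (∂_x^k b) ∂_x^{i + j - k}` for all integers `i`, `j`.
The coefficient of `∂_x^m` collects the terms with `i + j - k = m`, of which only finitely many
are not zero. -/
def comp {n : ℕ} (a b : PsiDO n) : PsiDO n :=
  ⟨fun m => ∑ᶠ p : ℤ × ℕ,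
      (Ring.choose p.1 p.2 : ℤ) • (a.1 p.1 * Dx^[p.2] (b.1 (m - p.1 + p.2))), by
    obtain ⟨K, hK⟩ := a.2
    obtain ⟨L, hL⟩ := b.2
    refine ⟨K + L, fun m hm => ?_⟩
    rw [← finsum_zero (α := ℤ × ℕ)]
    refine finsum_congr fun p => ?_
    rcases lt_or_ge K p.1 with h | h
    · rw [hK _ h, zero_mul, smul_zero]
    · rw [hL (m - p.1 + p.2) (by omega), Dx_iterate_zero, mul_zero, smul_zero]⟩

/-- Matrices of formal pseudo-differential operators. -/
abbrev MatOp (n : ℕ) := Fin (n + 2) → Fin (n + 2) → PsiDO n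

/-- Composition of matrix operators. -/
def MatOp.comp {n : ℕ} (P Q : MatOp n) : MatOp n :=
  fun α β => ∑ γ, WDVV.comp (P α γ) (Q γ β)

/-- Two matrix operators agree on the jets of curves in `V`. -/
def MatOp.EqOn {n : ℕ} (P Q : MatOp n) (V : Set (Pt n)) : Prop :=
  ∀ α β k, ∀ u : Jet n, u 0 ∈ V → (P α β).1 k u = (Q α β).1 k u

/-- A matrix operator is local on the jets of curves in `V` if it is a differential operator
there: it contains no negative powers of `∂_x`. -/
def MatOp.IsLocalOn {n : ℕ} (P : MatOp n) (V : Set (Pt n)) : Prop :=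
  ∀ α β k, k < 0 → ∀ u : Jet n, u 0 ∈ V → (P α β).1 k u = 0

/-! ### Operators of hydrodynamic type -/

/-- The data of an operator `P^{αβ} = g^{αβ}(v) ∂_x + Γ^{αβ}_γ(v) v^γ_x` of hydrodynamic type. -/
structure HydroOp (n : ℕ) where
  /-- `g^{αβ}` -/
  g : Fin (n + 2) → Fin (n + 2) → Pt n → ℂ
  /-- `Γ^{αβ}_γ` -/
  Γ : Fin (n + 2) → Fin (n + 2) → Fin (n + 2) → Pt n → ℂ

/-- The operator `g^{αβ}(w) ∂_y + Γ^{αβ}_γ(w) w^γ_y` in the dependent variables `w = w(v)` and the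
independent variable `y` with `dy = ρ(v) dx`, i.e. `∂_y = ρ⁻¹ ∂_x`, written as an operator in
`∂_x`. -/
def HydroOp.inVars {n : ℕ} (P : HydroOp n) (ρ : Pt n → ℂ) (w : Pt n → Pt n) : MatOp n :=
  fun α β =>
    mono (ofPt fun v => P.g α β (w v) * (ρ v)⁻¹) 1 +
      mono (∑ γ, ofPt (fun v => P.Γ α β γ (w v) * (ρ v)⁻¹) * Dx (ofPt fun v => w v γ)) 0

/-- The operator `g^{αβ}(v) ∂_x + Γ^{αβ}_γ(v) v^γ_x` in the original variables. -/
def HydroOp.toOp {n : ℕ} (P : HydroOp n) : MatOp n := P.inVars (fun _ => 1) id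

/-- The first Hamiltonian structure `P₁^{αβ} = η^{αβ} ∂_x`. -/
def P1 (n : ℕ) : HydroOp n where
  g := fun α β _ => eta α β
  Γ := fun _ _ _ _ => 0

/-- The second Hamiltonian structure of a conformal solution with charge `d` and spectrum `μ`:
`g^{αβ} = ∑_γ (1 - d/2 - μ_γ) v^γ c^{αβ}_γ` and `Γ^{αβ}_γ = (½ - μ_β) c^{αβ}_γ`. -/
def P2 {n : ℕ} (F : Pt n → ℂ) (d : ℂ) (μ : Fin (n + 2) → ℂ) : HydroOp n where
  g := fun α β v => ∑ γ, (1 - d / 2 - μ γ) * v γ * cUp F α β γ v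
  Γ := fun α β γ v => (1 / 2 - μ β) * cUp F α β γ v

/-! ### Reciprocal transformations

Let `y` be the new independent variable, `dy = ρ(v) dx`, and `w = w(v)` the new dependent
variables.  If `v` moves along the flow `v_t = X` and `ρ(v)_t = ∂_x σ`, then
`dy = ρ dx + σ dt`, so that the derivative in `t` at fixed `y` is `∂_t - (σ / ρ) ∂_x`, and hence
`w` as a function of `y` moves along
`w^α_t = (∂w^α/∂v^β) X^β - ρ⁻¹ w^α_x ∂_x⁻¹ ((∂ρ/∂v^β) X^β)`.
This is the operator `linOp` applied to `X`.  Bivectors are transformed by `P ↦ L ∘ P ∘ L*`, where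
`L = linOp` and the adjoint `L*` is taken with respect to the pairings `∫ ξ_α W^α dy` and
`∫ ζ_β X^β dx`; since `dy = ρ dx`, integration by parts gives
`(L* ξ)_β = ρ (∂w^α/∂v^β) ξ_α + (∂ρ/∂v^β) ∂_x⁻¹ (w^α_x ξ_α)`. -/

/-- The linearization `L` of the map that takes the function `v` of `x` to the function `w` of `y`:
`L^α_β = ∂w^α/∂v^β - ρ⁻¹ w^α_x ∂_x⁻¹ ∘ ∂ρ/∂v^β`. -/
def linOp {n : ℕ} (ρ : Pt n → ℂ) (w : Pt n → Pt n) : MatOp n := fun α β =>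
  mono (ofPt (pd β fun v => w v α)) 0 -
    comp (mono (ofPt (fun v => (ρ v)⁻¹) * Dx (ofPt fun v => w v α)) (-1))
      (mono (ofPt (pd β ρ)) 0)

/-- The adjoint of `linOp` with respect to `dy = ρ dx` and `dx`:
`(L*)_β^α = ρ ∂w^α/∂v^β + ∂ρ/∂v^β ∂_x⁻¹ ∘ w^α_x`. -/
def linOpAdj {n : ℕ} (ρ : Pt n → ℂ) (w : Pt n → Pt n) : MatOp n := fun β α =>
  mono (ofPt (fun v => ρ v * pd β (fun v' => w v' α) v)) 0 +
    comp (mono (ofPt (pd β ρ)) (-1)) (mono (Dx (ofPt fun v => w v α)) 0)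

/-- The image of an operator `P` under the reciprocal transformation `dy = ρ dx + …` followed by
the change of dependent variables `w = w(v)`.  In general it is a nonlocal operator. -/
def reciprocal {n : ℕ} (ρ : Pt n → ℂ) (w : Pt n → Pt n) (P : MatOp n) : MatOp n :=
  (linOp ρ w).comp (P.comp (linOpAdj ρ w))

/-- The density `θ_{1,0}(v) = v_1 = η_{1β} v^β` (which is the last coordinate of `v`): the
coefficient of `dx = dt^{1,0}` in `dx̂ = ∑ θ_{α,p}(v) dt^{α,p}`. -/
def theta10 {n : ℕ} (v : Pt n) : ℂ := ∑ β, eta 0 β * v β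

/-- The action on operators of the reciprocal transformation `dx̂ = ∑ θ_{α,p}(v) dt^{α,p}`, with
the inversion as the change of dependent variables. -/
def Phi {n : ℕ} (P : MatOp n) : MatOp n := reciprocal theta10 inv P

/-- The operator of hydrodynamic type `P`, in the inverted dependent variables `v̂ = inv v` and the
new independent variable `x̂`, `∂_x̂ = θ_{1,0}(v)⁻¹ ∂_x`. -/
def HydroOp.hat {n : ℕ} (P : HydroOp n) : MatOp n := P.inVars theta10 inv

end WDVV

end

/-!
Write `ρ = v^N` and let `J` be the Jacobian matrix of the inversion.  Everything rests on the shape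
of `M = ρ J` (`scaledJac`): a constant matrix, plus `η_{βν} v^ν` in the row `1`, minus `v̂` in the
column `N`.  Hence `∂_x M^δ_β = δ^δ_1 η_{βν} v^ν_x - δ_{βN} v̂^δ_x`, the inversion is conformal,
`M η Mᵀ = η`, and it takes the Euler vector field to the one with the weights of the inverted charge
and spectrum.

*Structure constants.*  Differentiating `ρ ∂_β (F̂ ∘ inv) = ∂_δ F̂ · M^δ_β` twice more expresses
`ĉ_{ζεδ} M^ζ_ν M^ε_γ M^δ_β` as `ρ (c_{νγβ} - η_{γβ} ∂_ν χ - η_{νβ} ∂_γ χ - η_{νγ} ∂_β χ)`, where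
`∂_1 F = ½ η_{αβ} v^α v^β + ρ χ` (`cubicInv_eq_sub`).  Since `F̂` has the metric `η`, the case
`ν = 1` gives `∂χ = 0` (`pd_chi_eq_zero`); so the multiplication is preserved by the inversion
(`cubicInv_eq_cLow`).

*Conformality.*  Because `χ` is locally constant, the derivative along `v^1` of the
quasihomogeneity equation of `F` shows that its quadratic polynomial contains `v^1` only in the
product `v^1 v^N` (`quadratic_terms_zero`).  Such polynomials become `ρ²` times quadratic polynomials
in `v̂` (`exists_isQuadratic_inv`).

*Operators.*  For `P = g ∂_x + h` put `R = P ∘ L*`.  Since `∂ρ/∂v^β = δ_{βN}`, all compositions are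
explicit, and the coefficients of negative order of `Φ(P)` vanish by an induction on the order
(`Phi_firstOrder_neg`) as soon as, for some constant `s`, `h^{γN} = s v^γ_x` and the coefficient of
order zero of `R^N` minus the derivative of that of order one is `s ρ v̂_x`.  For `P₁` this holds with
`s = 0`; for `P₂` with `s = ½ - d/2`, because `g^{Nβ}` is the Euler vector field and
`h^{Nβ} = (½ - μ_β) v^β_x`.  The coefficients of order one and zero agree with those of the
transformed operator by `M η Mᵀ = η` and the transformation law of the structure constants
(`Phi_toOp_eqOn`, `Phi_P1_eqOn`, `Phi_P2_eqOn`).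
-/

open Topology

namespace WDVV

variable {n : ℕ}

/-! ### Partial derivatives -/

theorem pd_congr {f g : Pt n → ℂ} {V : Set (Pt n)} (hV : IsOpen V) (h : ∀ v ∈ V, f v = g v)
    (α : Fin (n + 2)) : ∀ v ∈ V, pd α f v = pd α g v := by
  intro v hv
  have : f =ᶠ[𝓝 v] g := Filter.eventually_of_mem (hV.mem_nhds hv) h
  simp only [pd, this.fderiv_eq]

theorem analyticAt_pd {f : Pt n → ℂ} {v : Pt n} (hf : AnalyticAt ℂ f v) (α : Fin (n + 2)) :
    AnalyticAt ℂ (pd α f) v :=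
  ((ContinuousLinearMap.apply ℂ ℂ (Pi.single α 1 : Pt n)).analyticAt _).comp hf.fderiv

theorem pd_comm {f : Pt n → ℂ} {v : Pt n} (hf : AnalyticAt ℂ f v) (α β : Fin (n + 2)) :
    pd α (pd β f) v = pd β (pd α f) v := by
  have hs : IsSymmSndFDerivAt ℂ f v := (AnalyticAt.contDiffAt hf).isSymmSndFDerivAt_of_omega
  have key : ∀ x y : Pt n, fderiv ℂ (fun w => fderiv ℂ f w y) v x = fderiv ℂ (fderiv ℂ f) v x y := by
    intro x y
    have := fderiv_clm_apply (𝕜 := ℂ) (c := fderiv ℂ f) (u := fun _ => y)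
      hf.fderiv.differentiableAt (differentiableAt_const y)
    rw [this]
    simp
  exact (key _ _).trans ((hs _ _).trans (key _ _).symm)

theorem pd_const (α : Fin (n + 2)) (c : ℂ) (v : Pt n) : pd α (fun _ => c) v = 0 := by
  simp [pd]

theorem pd_coord (α β : Fin (n + 2)) (v : Pt n) :
    pd α (fun v => v β) v = if α = β then 1 else 0 := by
  have : fderiv ℂ (fun v : Pt n => v β) v = ContinuousLinearMap.proj β :=
    (ContinuousLinearMap.proj (R := ℂ) (φ := fun _ : Fin (n + 2) => ℂ) β).fderiv
  simp only [pd, this]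
  simp [Pi.single_apply, eq_comm]

section
variable {f g : Pt n → ℂ} {v : Pt n}

theorem pd_add (hf : AnalyticAt ℂ f v) (hg : AnalyticAt ℂ g v) (α : Fin (n + 2)) :
    pd α (fun v => f v + g v) v = pd α f v + pd α g v := by
  simp only [pd]
  rw [fderiv_fun_add hf.differentiableAt hg.differentiableAt]; rfl

theorem pd_sub (hf : AnalyticAt ℂ f v) (hg : AnalyticAt ℂ g v) (α : Fin (n + 2)) :
    pd α (fun v => f v - g v) v = pd α f v - pd α g v := by
  simp only [pd]
  rw [fderiv_fun_sub hf.differentiableAt hg.differentiableAt]; rfl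

theorem pd_mul (hf : AnalyticAt ℂ f v) (hg : AnalyticAt ℂ g v) (α : Fin (n + 2)) :
    pd α (fun v => f v * g v) v = pd α f v * g v + f v * pd α g v := by
  simp only [pd]
  rw [fderiv_fun_mul hf.differentiableAt hg.differentiableAt]
  simp [mul_comm]; ring

theorem pd_const_mul (c : ℂ) (f : Pt n → ℂ) (v : Pt n) (α : Fin (n + 2)) :
    pd α (fun v => c * f v) v = c * pd α f v := by
  simp only [pd]
  have : (fun v => c * f v) = c • f := rfl
  rw [this, fderiv_const_smul_field]; rfl

theorem pd_sum {ι : Type*} (s : Finset ι) {f : ι → Pt n → ℂ} (hf : ∀ i, AnalyticAt ℂ (f i) v)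
    (α : Fin (n + 2)) : pd α (fun v => ∑ i ∈ s, f i v) v = ∑ i ∈ s, pd α (f i) v := by
  simp only [pd]
  rw [fderiv_fun_sum fun i _ => (hf i).differentiableAt]
  simp

end

theorem analyticAt_coord (α : Fin (n + 2)) (v : Pt n) : AnalyticAt ℂ (fun v : Pt n => v α) v :=
  (ContinuousLinearMap.proj (R := ℂ) (φ := fun _ : Fin (n + 2) => ℂ) α).analyticAt v

theorem analyticAt_sum {ι : Type*} (s : Finset ι) {f : ι → Pt n → ℂ} {v : Pt n}
    (hf : ∀ i, AnalyticAt ℂ (f i) v) : AnalyticAt ℂ (fun v => ∑ i ∈ s, f i v) v :=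
  Finset.analyticAt_fun_sum s fun i _ => hf i

theorem fderiv_apply_eq_sum_pd {f : Pt n → ℂ} (v X : Pt n) :
    fderiv ℂ f v X = ∑ α, pd α f v * X α := by
  conv_lhs => rw [← Finset.univ_sum_single X]
  rw [map_sum]
  refine Finset.sum_congr rfl fun α _ => ?_
  have : (Pi.single α (X α) : Pt n) = X α • Pi.single α 1 := by
    rw [← Pi.single_smul]; simp
  rw [this, map_smul, smul_eq_mul, mul_comm]; rfl

theorem pd_comp {w : Pt n → Pt n} {φ : Pt n → ℂ} {v : Pt n} (hφ : AnalyticAt ℂ φ (w v))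
    (hw : ∀ δ, AnalyticAt ℂ (fun v => w v δ) v) (β : Fin (n + 2)) :
    pd β (fun v => φ (w v)) v = ∑ δ, pd δ φ (w v) * pd β (fun v => w v δ) v := by
  have hd : DifferentiableAt ℂ w v := differentiableAt_pi.2 fun δ => (hw δ).differentiableAt
  have h := fderiv_comp v hφ.differentiableAt hd
  have : pd β (fun v => φ (w v)) v = fderiv ℂ (φ ∘ w) v (Pi.single β 1) := rfl
  rw [this, h, ContinuousLinearMap.comp_apply, fderiv_apply_eq_sum_pd]
  refine Finset.sum_congr rfl fun δ _ => ?_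
  congr 1
  rw [fderiv_pi fun δ => (hw δ).differentiableAt]; rfl

/-! ### The metric and the structure constants -/

theorem sum_eta_mul (α : Fin (n + 2)) (x : Fin (n + 2) → ℂ) :
    ∑ ν, eta α ν * x ν = x (Fin.rev α) := by
  simp [eta]

theorem cMid_eq (F : Pt n → ℂ) (α β γ : Fin (n + 2)) :
    cMid F α β γ = cLow F (Fin.rev α) β γ := by
  funext v
  exact sum_eta_mul _ fun ν => cLow F ν β γ v

theorem cUp_eq (F : Pt n → ℂ) (α β γ : Fin (n + 2)) :
    cUp F α β γ = cLow F (Fin.rev β) (Fin.rev α) γ := by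
  funext v
  simp only [cUp, cMid_eq]
  exact sum_eta_mul _ fun ν => cLow F _ ν γ v

theorem theta10_eq : (theta10 : Pt n → ℂ) = fun v => v (Fin.last (n + 1)) := by
  funext v
  simp only [theta10]
  rw [sum_eta_mul, Fin.rev_zero]

theorem etaQuad_eq (v : Pt n) : etaQuad v = ∑ α, v α * v (Fin.rev α) := by
  refine Finset.sum_congr rfl fun α _ => ?_
  simp only [mul_right_comm _ (v α)]
  rw [← Finset.sum_mul, sum_eta_mul, mul_comm]

theorem analyticAt_cLow {F : Pt n → ℂ} {v : Pt n} (hF : AnalyticAt ℂ F v) (α β γ : Fin (n + 2)) :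
    AnalyticAt ℂ (cLow F α β γ) v :=
  analyticAt_pd (analyticAt_pd (analyticAt_pd hF γ) β) α

theorem cLow_swap_left {F : Pt n → ℂ} {v : Pt n} (hF : AnalyticAt ℂ F v) (α β γ : Fin (n + 2)) :
    cLow F α β γ v = cLow F β α γ v :=
  pd_comm (analyticAt_pd hF γ) α β

theorem cLow_swap_right {F : Pt n → ℂ} {U : Set (Pt n)} (hU : IsOpen U)
    (hF : AnalyticOnNhd ℂ F U) {v : Pt n} (hv : v ∈ U) (α β γ : Fin (n + 2)) :
    cLow F α β γ v = cLow F α γ β v :=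
  pd_congr hU (fun w hw => pd_comm (hF w hw) β γ) α v hv

theorem IsSolution.cLow_zero_right {F : Pt n → ℂ} {U : Set (Pt n)} (hF : IsSolution F U)
    {v : Pt n} (hv : v ∈ U) (α β : Fin (n + 2)) :
    cLow F α β 0 v = if β = Fin.rev α then 1 else 0 := by
  rw [cLow_swap_right hF.isOpen hF.analytic hv, cLow_swap_left (hF.analytic v hv),
    hF.metric v hv]; rfl

theorem IsSolution.cLow_zero_mid {F : Pt n → ℂ} {U : Set (Pt n)} (hF : IsSolution F U)
    {v : Pt n} (hv : v ∈ U) (α β : Fin (n + 2)) :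
    cLow F α 0 β v = if β = Fin.rev α then 1 else 0 := by
  rw [cLow_swap_left (hF.analytic v hv), hF.metric v hv]; rfl

theorem isOpen_regular {U : Set (Pt n)} (hU : IsOpen U) : IsOpen (regular U) :=
  hU.inter (isOpen_ne_fun (continuous_apply _) continuous_const)

/-! ### The Jacobian of the inversion -/

theorem pd_half_etaQuad (β : Fin (n + 2)) (v : Pt n) :
    pd β (fun v => 1 / 2 * etaQuad v) v = v (Fin.rev β) := by
  have h : (fun v : Pt n => 1 / 2 * etaQuad v)
      = fun v => 1 / 2 * (fun v : Pt n => ∑ α, v α * v (Fin.rev α)) v := by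
    funext v; rw [etaQuad_eq]
  rw [h, pd_const_mul, pd_sum (f := fun α (v : Pt n) => v α * v (Fin.rev α)) _
    fun α => (analyticAt_coord α v).mul (analyticAt_coord _ v)]
  have h2 : ∀ α, pd β (fun v : Pt n => v α * v (Fin.rev α)) v
      = (if β = α then 1 else 0) * v (Fin.rev α) + v α * (if β = Fin.rev α then 1 else 0) := by
    intro α
    rw [pd_mul (analyticAt_coord α v) (analyticAt_coord _ v), pd_coord, pd_coord]
  simp only [h2, Finset.sum_add_distrib, ite_mul, one_mul, zero_mul, mul_ite, mul_one, mul_zero]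
  have h3 : ∀ α, (β = Fin.rev α) ↔ (Fin.rev β = α) := fun α => by
    rw [Fin.rev_eq_iff, eq_comm, eq_comm (b := β)]
  simp only [h3, Finset.sum_ite_eq, Finset.mem_univ, if_true]
  ring

theorem analyticAt_half_etaQuad (v : Pt n) : AnalyticAt ℂ (fun v : Pt n => 1 / 2 * etaQuad v) v := by
  simp only [etaQuad_eq]
  exact analyticAt_const.mul
    (analyticAt_sum _ fun α => (analyticAt_coord α v).mul (analyticAt_coord _ v))

theorem analyticAt_inv {v : Pt n} (hv : v (Fin.last (n + 1)) ≠ 0) (δ : Fin (n + 2)) :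
    AnalyticAt ℂ (fun v : Pt n => inv v δ) v := by
  simp only [inv]
  split_ifs
  · exact (analyticAt_half_etaQuad v).div (analyticAt_coord _ v) hv
  · exact analyticAt_const.div (analyticAt_coord _ v) hv
  · exact (analyticAt_coord _ v).div (analyticAt_coord _ v) hv

/-- The Jacobian matrix of the inversion, multiplied by `v^N`.  In this normalization it is the
sum of a constant matrix, a matrix linear in `v` with only the row `1` nonzero, and a matrix with
only the column `N` nonzero, whose entries are those of `-v̂`. -/
noncomputable def scaledJac (δ β : Fin (n + 2)) (v : Pt n) : ℂ :=
  (if δ = β ∧ δ ≠ 0 ∧ δ ≠ Fin.last (n + 1) then 1 else 0) + (if δ = 0 then v (Fin.rev β) else 0)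
    - (if β = Fin.last (n + 1) then inv v δ else 0)

theorem mul_pd_inv {v : Pt n} (hv : v (Fin.last (n + 1)) ≠ 0) (δ β : Fin (n + 2)) :
    v (Fin.last (n + 1)) * pd β (fun v => inv v δ) v = scaledJac δ β v := by
  have hV : IsOpen {v : Pt n | v (Fin.last (n + 1)) ≠ 0} :=
    isOpen_ne_fun (continuous_apply _) continuous_const
  have h1 := pd_mul (analyticAt_coord (Fin.last (n + 1)) v) (analyticAt_inv hv δ) β
  -- `v^N v̂^δ` is a polynomial in `v`
  have h2 := pd_congr hV (f := fun v : Pt n => v (Fin.last (n + 1)) * inv v δ)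
    (g := fun v => if δ = 0 then 1 / 2 * etaQuad v else if δ = Fin.last (n + 1) then -1 else v δ)
    (by
      intro w hw
      have hw' : w (Fin.last (n + 1)) ≠ 0 := hw
      simp only [inv]
      split_ifs <;> field_simp) β v hv
  rw [h1, pd_coord] at h2
  have h3 : pd β (fun v : Pt n =>
        if δ = 0 then 1 / 2 * etaQuad v else if δ = Fin.last (n + 1) then -1 else v δ) v
      = (if δ = β ∧ δ ≠ 0 ∧ δ ≠ Fin.last (n + 1) then 1 else 0)
        + (if δ = 0 then v (Fin.rev β) else 0) := by
    by_cases h0 : δ = 0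
    · simp only [h0, if_true, pd_half_etaQuad]
      simp
    · by_cases hN : δ = Fin.last (n + 1)
      · simp [hN, pd_const]
      · simp [h0, hN, pd_coord, eq_comm]
  rw [h3] at h2
  simp only [scaledJac]
  rw [← h2]
  split_ifs <;> ring

theorem pd_inv {v : Pt n} (hv : v (Fin.last (n + 1)) ≠ 0) (δ β : Fin (n + 2)) :
    pd β (fun v => inv v δ) v = scaledJac δ β v / v (Fin.last (n + 1)) := by
  rw [eq_div_iff hv, mul_comm, mul_pd_inv hv]

theorem analyticAt_scaledJac {v : Pt n} (hv : v (Fin.last (n + 1)) ≠ 0) (δ β : Fin (n + 2)) :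
    AnalyticAt ℂ (scaledJac δ β) v := by
  have h1 : AnalyticAt ℂ (fun v : Pt n => if δ = 0 then v (Fin.rev β) else 0) v := by
    split_ifs
    exacts [analyticAt_coord _ v, analyticAt_const]
  have h2 : AnalyticAt ℂ (fun v : Pt n => if β = Fin.last (n + 1) then inv v δ else 0) v := by
    split_ifs
    exacts [analyticAt_inv hv δ, analyticAt_const]
  exact (analyticAt_const.add h1).sub h2

theorem pd_scaledJac {v : Pt n} (hv : v (Fin.last (n + 1)) ≠ 0) (δ β ν : Fin (n + 2)) :
    v (Fin.last (n + 1)) * pd ν (scaledJac δ β) v =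
      (if δ = 0 then if ν = Fin.rev β then v (Fin.last (n + 1)) else 0 else 0)
        - if β = Fin.last (n + 1) then scaledJac δ ν v else 0 := by
  have h1 : AnalyticAt ℂ (fun v : Pt n => if δ = 0 then v (Fin.rev β) else 0) v := by
    split_ifs
    exacts [analyticAt_coord _ v, analyticAt_const]
  have h2 : AnalyticAt ℂ (fun v : Pt n => if β = Fin.last (n + 1) then inv v δ else 0) v := by
    split_ifs
    exacts [analyticAt_inv hv δ, analyticAt_const]
  have h0 : AnalyticAt ℂ (fun _ : Pt n =>
      if δ = β ∧ δ ≠ 0 ∧ δ ≠ Fin.last (n + 1) then (1 : ℂ) else 0) v := analyticAt_const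
  have e : pd ν (scaledJac δ β) v = _ := (pd_sub (h0.add h1) h2 ν).trans
    (congrArg (· - _) (pd_add h0 h1 ν))
  rw [e, pd_const, zero_add, mul_sub]
  congr 1
  · split_ifs with h h'
    · simp [pd_coord, h']
    · simp [pd_coord, h']
    · simp [pd_const]
  · split_ifs
    · exact mul_pd_inv hv δ ν
    · simp [pd_const]

theorem scaledJac_zero_right (δ : Fin (n + 2)) (v : Pt n) :
    scaledJac δ 0 v = if δ = 0 then v (Fin.last (n + 1)) else 0 := by
  have : (0 : Fin (n + 2)) ≠ Fin.last (n + 1) := (Fin.last_pos).ne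
  by_cases h : δ = 0 <;> simp [scaledJac, h, this]

/-- The sum of `x` against a row of `scaledJac`. -/
theorem sum_scaledJac_mul (δ : Fin (n + 2)) (v : Pt n) (x : Fin (n + 2) → ℂ) :
    ∑ β, scaledJac δ β v * x β =
      (if δ ≠ 0 ∧ δ ≠ Fin.last (n + 1) then x δ else 0)
        + (if δ = 0 then ∑ β, v (Fin.rev β) * x β else 0) - inv v δ * x (Fin.last (n + 1)) := by
  simp only [scaledJac, add_mul, sub_mul, Finset.sum_add_distrib, Finset.sum_sub_distrib]
  congr 1
  · congr 1
    · by_cases h : δ ≠ 0 ∧ δ ≠ Fin.last (n + 1) <;> simp [h]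
    · split_ifs <;> simp
  · simp

theorem sum_rev_mul (v x : Fin (n + 2) → ℂ) :
    ∑ β, v (Fin.rev β) * x β = ∑ β, v β * x (Fin.rev β) := by
  rw [← Equiv.sum_comp Fin.revPerm]
  simp

theorem mul_inv_zero {v : Pt n} (hv : v (Fin.last (n + 1)) ≠ 0) :
    v (Fin.last (n + 1)) * inv v 0 = 1 / 2 * etaQuad v := by
  simp only [inv, if_true]
  field_simp

theorem mul_inv_last {v : Pt n} (hv : v (Fin.last (n + 1)) ≠ 0) :
    v (Fin.last (n + 1)) * inv v (Fin.last (n + 1)) = -1 := by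
  simp only [inv, if_true, Fin.last_pos.ne', if_false]
  field_simp

theorem mul_inv_mid {v : Pt n} (hv : v (Fin.last (n + 1)) ≠ 0) {α : Fin (n + 2)}
    (h0 : α ≠ 0) (hN : α ≠ Fin.last (n + 1)) : v (Fin.last (n + 1)) * inv v α = v α := by
  simp only [inv, h0, hN, if_false]
  field_simp

theorem rev_eq_zero_iff (α : Fin (n + 2)) : Fin.rev α = 0 ↔ α = Fin.last (n + 1) := by
  rw [Fin.rev_eq_iff, Fin.rev_zero]

theorem rev_eq_last_iff (α : Fin (n + 2)) : Fin.rev α = Fin.last (n + 1) ↔ α = 0 := by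
  rw [Fin.rev_eq_iff, Fin.rev_last]

/-- The inversion is conformal: its Jacobian matrix `J` satisfies `(v^N)² J η Jᵀ = η`. -/
theorem sum_scaledJac_mul_scaledJac_rev {v : Pt n} (hv : v (Fin.last (n + 1)) ≠ 0)
    (α δ : Fin (n + 2)) :
    ∑ γ, scaledJac α γ v * scaledJac δ (Fin.rev γ) v = if δ = Fin.rev α then 1 else 0 := by
  have h0N : Fin.last (n + 1) ≠ 0 := (Fin.last_pos).ne'
  have h1 := mul_inv_zero hv
  have h2 := mul_inv_last hv
  have e : ∑ β, v (Fin.rev β) * scaledJac δ (Fin.rev β) v = ∑ β, scaledJac δ β v * v β := by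
    rw [← Equiv.sum_comp Fin.revPerm]
    simp [mul_comm]
  rw [sum_scaledJac_mul, e, sum_scaledJac_mul, sum_rev_mul, ← etaQuad_eq, Fin.rev_last,
    scaledJac_zero_right]
  by_cases hα0 : α = 0
  · subst hα0
    by_cases hδ0 : δ = 0
    · subst hδ0
      simp only [ne_eq, not_true, false_and, if_false, if_true, Fin.rev_zero, h0N.symm]
      linear_combination -2 * h1
    · by_cases hδN : δ = Fin.last (n + 1)
      · subst hδN
        simp [h0N]
        linear_combination -h2
      · simp [hδ0, hδN]
        linear_combination -mul_inv_mid hv hδ0 hδN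
  · by_cases hαN : α = Fin.last (n + 1)
    · subst hαN
      by_cases hδ0 : δ = 0
      · simp [hδ0, h0N]
        linear_combination -h2
      · simp [hδ0, h0N]
    · have h3 := mul_inv_mid hv hα0 hαN
      have h4 : Fin.rev α ≠ Fin.last (n + 1) := by rwa [ne_eq, rev_eq_last_iff]
      have h5 : Fin.rev α ≠ 0 := by rwa [ne_eq, rev_eq_zero_iff]
      by_cases hδ0 : δ = 0
      · simp [hδ0, hα0, hαN, scaledJac, h4, h5.symm]
        linear_combination -h3
      · have : (δ = Fin.rev α ∧ δ ≠ 0 ∧ δ ≠ Fin.last (n + 1)) ↔ δ = Fin.rev α :=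
          ⟨fun h => h.1, fun h => ⟨h, hδ0, h ▸ h4⟩⟩
        simp only [scaledJac, this]
        simp [hδ0, hα0, hαN, h4]

/-- The inversion is conformal: its Jacobian matrix `J` satisfies `(v^N)² Jᵀ η J = η`. -/
theorem sum_scaledJac_mul_scaledJac {v : Pt n} (hv : v (Fin.last (n + 1)) ≠ 0)
    (β γ : Fin (n + 2)) :
    ∑ δ, scaledJac δ β v * scaledJac (Fin.rev δ) γ v = if γ = Fin.rev β then 1 else 0 := by
  let A : Matrix (Fin (n + 2)) (Fin (n + 2)) ℂ := Matrix.of fun δ β => scaledJac δ β v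
  let B : Matrix (Fin (n + 2)) (Fin (n + 2)) ℂ :=
    Matrix.of fun β δ => scaledJac (Fin.rev δ) (Fin.rev β) v
  have hAB : A * B = 1 := by
    ext α δ
    rw [Matrix.mul_apply, Matrix.one_apply]
    refine (sum_scaledJac_mul_scaledJac_rev hv α (Fin.rev δ)).trans ?_
    simp [eq_comm]
  have hBA : B * A = 1 := mul_eq_one_comm.1 hAB
  have h := congrArg (fun X : Matrix _ _ ℂ => X (Fin.rev γ) β) hBA
  simp only [Matrix.mul_apply, Matrix.one_apply] at h
  simp only [A, B, Matrix.of_apply, Fin.rev_rev] at h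
  simp only [mul_comm (scaledJac _ β v)]
  rw [h]
  simp [Fin.rev_eq_iff]

theorem sum_rev_mul_weight {c : ℂ} {q : Fin (n + 2) → ℂ} (hq : ∀ α, q α + q (Fin.rev α) = c)
    (v : Pt n) : ∑ β, v (Fin.rev β) * (q β * v β) = c * (1 / 2 * etaQuad v) := by
  have e : ∑ β, v (Fin.rev β) * (q β * v β) = ∑ β, v β * (q (Fin.rev β) * v (Fin.rev β)) :=
    sum_rev_mul v fun β => q β * v β
  have e2 : ∑ β, v (Fin.rev β) * (q β * v β) + ∑ β, v (Fin.rev β) * (q β * v β)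
      = c * etaQuad v := by
    nth_rewrite 2 [e]
    rw [← Finset.sum_add_distrib, etaQuad_eq, Finset.mul_sum]
    refine Finset.sum_congr rfl fun β _ => ?_
    rw [← hq β]; ring
  linear_combination e2 / 2

/-- The Euler vector field with weights `q`, where `q_α + q_{rev α} = c` for all `α`, is taken by
the inversion to the Euler vector field with weights `q̂_1 = c - q_N`, `q̂_N = -q_N` and
`q̂_i = q_i - q_N` for the other indices. -/
theorem sum_scaledJac_mul_euler {v : Pt n} (hv : v (Fin.last (n + 1)) ≠ 0) {c : ℂ}
    {q : Fin (n + 2) → ℂ} (hq : ∀ α, q α + q (Fin.rev α) = c) (δ : Fin (n + 2)) :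
    ∑ β, scaledJac δ β v * (q β * v β) =
      v (Fin.last (n + 1)) * (((if δ = 0 then c else if δ = Fin.last (n + 1) then 0 else q δ)
        - q (Fin.last (n + 1))) * inv v δ) := by
  have h0N : Fin.last (n + 1) ≠ 0 := (Fin.last_pos).ne'
  rw [sum_scaledJac_mul, sum_rev_mul_weight hq, ← mul_inv_zero hv]
  by_cases h0 : δ = 0
  · simp [h0]; ring
  · by_cases hN : δ = Fin.last (n + 1)
    · simp [hN, h0N]; ring
    · simp only [h0, hN, ne_eq, not_false_eq_true, and_self, if_true, if_false]
      linear_combination -q δ * mul_inv_mid hv h0 hN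

/-! ### The third derivatives of the inverted solution -/

/-- The contraction `∑_δ ψ_δ J^δ_β` with the Jacobian matrix of the inversion, normalized as
`scaledJac`. -/
noncomputable def contr (ψ : Fin (n + 2) → Pt n → ℂ) (β : Fin (n + 2)) (v : Pt n) : ℂ :=
  ∑ δ, ψ δ v * scaledJac δ β v

theorem mul_pd_comp_inv {v : Pt n} (hv : v (Fin.last (n + 1)) ≠ 0) {φ : Pt n → ℂ}
    (hφ : AnalyticAt ℂ φ (inv v)) (β : Fin (n + 2)) :
    v (Fin.last (n + 1)) * pd β (fun v => φ (inv v)) v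
      = contr (fun δ v => pd δ φ (inv v)) β v := by
  rw [pd_comp hφ (analyticAt_inv hv), Finset.mul_sum]
  refine Finset.sum_congr rfl fun δ _ => ?_
  rw [pd_inv hv]
  field_simp

theorem analyticAt_comp_inv {v : Pt n} (hv : v (Fin.last (n + 1)) ≠ 0) {φ : Pt n → ℂ}
    (hφ : AnalyticAt ℂ φ (inv v)) : AnalyticAt ℂ (fun v => φ (inv v)) v :=
  AnalyticAt.fun_comp hφ (analyticAt_pi_iff.2 (analyticAt_inv hv))

theorem analyticAt_contr {v : Pt n} (hv : v (Fin.last (n + 1)) ≠ 0) {ψ : Fin (n + 2) → Pt n → ℂ}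
    (hψ : ∀ δ, AnalyticAt ℂ (ψ δ) v) (β : Fin (n + 2)) : AnalyticAt ℂ (contr ψ β) v :=
  analyticAt_sum _ fun δ => (hψ δ).mul (analyticAt_scaledJac hv δ β)

theorem mul_pd_contr {v : Pt n} (hv : v (Fin.last (n + 1)) ≠ 0) {ψ : Fin (n + 2) → Pt n → ℂ}
    (hψ : ∀ δ, AnalyticAt ℂ (ψ δ) v) (β ν : Fin (n + 2)) :
    v (Fin.last (n + 1)) * pd ν (contr ψ β) v
      = contr (fun δ v => v (Fin.last (n + 1)) * pd ν (ψ δ) v) β v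
        + (if ν = Fin.rev β then 1 else 0) * (v (Fin.last (n + 1)) * ψ 0 v)
        - (if β = Fin.last (n + 1) then 1 else 0) * contr ψ ν v := by
  have h1 : pd ν (contr ψ β) v = ∑ δ, pd ν (fun v => ψ δ v * scaledJac δ β v) v :=
    pd_sum _ (fun δ => (hψ δ).mul (analyticAt_scaledJac hv δ β)) ν
  have h2 : ∀ δ, v (Fin.last (n + 1)) * pd ν (fun v => ψ δ v * scaledJac δ β v) v
      = v (Fin.last (n + 1)) * pd ν (ψ δ) v * scaledJac δ β v
        + ψ δ v * (if δ = 0 then if ν = Fin.rev β then v (Fin.last (n + 1)) else 0 else 0)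
        - (if β = Fin.last (n + 1) then 1 else 0) * (ψ δ v * scaledJac δ ν v) := by
    intro δ
    rw [pd_mul (hψ δ) (analyticAt_scaledJac hv δ β), mul_add, mul_left_comm _ (ψ δ v),
      pd_scaledJac hv]
    split_ifs <;> ring
  rw [h1, Finset.mul_sum]
  simp only [h2, Finset.sum_add_distrib, Finset.sum_sub_distrib, ← Finset.mul_sum]
  simp only [contr]
  congr 2
  simp [mul_comm]

theorem contr_zero (ψ : Fin (n + 2) → Pt n → ℂ) (v : Pt n) :
    contr ψ 0 v = v (Fin.last (n + 1)) * ψ 0 v := by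
  simp [contr, scaledJac_zero_right, mul_comm]

theorem pd_coord_mul {f : Pt n → ℂ} {v : Pt n} (hf : AnalyticAt ℂ f v) (α κ : Fin (n + 2)) :
    pd α (fun v => v κ * f v) v = (if α = κ then 1 else 0) * f v + v κ * pd α f v := by
  rw [pd_mul (analyticAt_coord κ v) hf, pd_coord]

section
variable {Fh : Pt n → ℂ} {V : Set (Pt n)}

/-- The Hessian of `F̂`, pulled back to the coordinates `v` by the (normalized) Jacobian matrix. -/
noncomputable def hessInv (Fh : Pt n → ℂ) (γ β : Fin (n + 2)) : Pt n → ℂ :=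
  contr (fun δ => contr (fun ε v => pd ε (pd δ Fh) (inv v)) γ) β

/-- The third derivatives of `F̂`, pulled back to the coordinates `v` by the (normalized) Jacobian
matrix. -/
noncomputable def cubicInv (Fh : Pt n → ℂ) (ν γ β : Fin (n + 2)) : Pt n → ℂ :=
  contr (fun δ => contr (fun ε => contr (fun ζ v => cLow Fh ζ ε δ (inv v)) ν) γ) β

theorem contr_congr {ψ ψ' : Fin (n + 2) → Pt n → ℂ} {v : Pt n} (h : ∀ δ, ψ δ v = ψ' δ v)
    (β : Fin (n + 2)) : contr ψ β v = contr ψ' β v := by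
  simp only [contr, h]

theorem contr_add_sub (ψ ψ' ψ'' : Fin (n + 2) → Pt n → ℂ) (a b : ℂ) (v : Pt n) (β : Fin (n + 2)) :
    contr (fun δ v => ψ δ v + a * ψ' δ v - b * ψ'' δ v) β v
      = contr ψ β v + a * contr ψ' β v - b * contr ψ'' β v := by
  simp only [contr, Finset.mul_sum, ← Finset.sum_add_distrib, ← Finset.sum_sub_distrib]
  exact Finset.sum_congr rfl fun _ _ => by ring

/-- The pulled back Hessian of `F̂` in terms of the derivatives of `G = F̂ ∘ inv`. -/
theorem hessInv_eq (hV : IsOpen V) (hVN : ∀ v ∈ V, v (Fin.last (n + 1)) ≠ 0)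
    (hA : ∀ v ∈ V, AnalyticAt ℂ Fh (inv v)) (γ β : Fin (n + 2)) :
    ∀ v ∈ V, hessInv Fh γ β v =
      v (Fin.last (n + 1)) * (v (Fin.last (n + 1)) * pd γ (pd β fun v => Fh (inv v)) v
        + (if γ = Fin.last (n + 1) then 1 else 0) * pd β (fun v => Fh (inv v)) v
        + (if β = Fin.last (n + 1) then 1 else 0) * pd γ (fun v => Fh (inv v)) v
        - (if γ = Fin.rev β then 1 else 0) * pd 0 (fun v => Fh (inv v)) v) := by
  intro v hv
  have hvN := hVN v hv
  have hG : AnalyticAt ℂ (fun v => Fh (inv v)) v := analyticAt_comp_inv hvN (hA v hv)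
  have h1 : ∀ β, ∀ v ∈ V, v (Fin.last (n + 1)) * pd β (fun v => Fh (inv v)) v
      = contr (fun δ v => pd δ Fh (inv v)) β v :=
    fun β v hv => mul_pd_comp_inv (hVN v hv) (hA v hv) β
  have h2 := pd_congr hV (h1 β) γ v hv
  rw [pd_coord_mul (analyticAt_pd hG β)] at h2
  have h3 := mul_pd_contr hvN
    (fun δ => analyticAt_comp_inv hvN (analyticAt_pd (hA v hv) δ)) β γ
  rw [← h2, ← h1 γ v hv, ← contr_zero (fun δ v => pd δ Fh (inv v)), ← h1 0 v hv] at h3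
  have h4 : hessInv Fh γ β v = contr (fun δ v => v (Fin.last (n + 1))
      * pd γ (fun v => pd δ Fh (inv v)) v) β v :=
    contr_congr (fun δ => (mul_pd_comp_inv hvN (analyticAt_pd (hA v hv) δ) γ).symm) β
  rw [h4]
  linear_combination -h3

theorem mul_pd_hessInv (hV : IsOpen V) (hVN : ∀ v ∈ V, v (Fin.last (n + 1)) ≠ 0)
    (hA : ∀ v ∈ V, AnalyticAt ℂ Fh (inv v)) (ν γ β : Fin (n + 2)) :
    ∀ v ∈ V, v (Fin.last (n + 1)) * pd ν (hessInv Fh γ β) v =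
      cubicInv Fh ν γ β v
        + v (Fin.last (n + 1)) ^ 2 *
          ((if ν = Fin.rev γ then 1 else 0) * pd β (pd 0 fun v => Fh (inv v)) v
          + (if ν = Fin.rev β then 1 else 0) * pd γ (pd 0 fun v => Fh (inv v)) v)
        - (if γ = Fin.last (n + 1) then 1 else 0) * hessInv Fh ν β v
        - (if β = Fin.last (n + 1) then 1 else 0) * hessInv Fh γ ν v := by
  intro v hv
  have hvN := hVN v hv
  have hA2 : ∀ ε δ, AnalyticAt ℂ (fun v => pd ε (pd δ Fh) (inv v)) v := fun ε δ =>
    analyticAt_comp_inv hvN (analyticAt_pd (analyticAt_pd (hA v hv) δ) ε)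
  have h1 := mul_pd_contr hvN (ψ := fun δ => contr (fun ε v => pd ε (pd δ Fh) (inv v)) γ)
    (fun δ => analyticAt_contr hvN (fun ε => hA2 ε δ) γ) β ν
  -- `∂F̂/∂v̂^1 = ∂G/∂v^1`, because the column `1` of the Jacobian matrix is the unit vector
  have h0 : ∀ γ, contr (fun ε v => pd ε (pd 0 Fh) (inv v)) γ v
      = v (Fin.last (n + 1)) * pd γ (pd 0 fun v => Fh (inv v)) v := by
    intro γ
    rw [← mul_pd_comp_inv hvN (analyticAt_pd (hA v hv) 0)]
    congr 1
    refine pd_congr hV (fun w hw => ?_) γ v hv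
    have := mul_pd_comp_inv (hVN w hw) (hA w hw) 0
    rw [contr_zero] at this
    exact (mul_left_cancel₀ (hVN w hw) this).symm
  have h2 : contr (fun δ v => v (Fin.last (n + 1))
        * pd ν (contr (fun ε v => pd ε (pd δ Fh) (inv v)) γ) v) β v
      = cubicInv Fh ν γ β v
        + (if ν = Fin.rev γ then 1 else 0) *
          (v (Fin.last (n + 1)) * contr (fun ε v => pd ε (pd 0 Fh) (inv v)) β v)
        - (if γ = Fin.last (n + 1) then 1 else 0) * hessInv Fh ν β v := by
    have e : contr (fun δ v => pd 0 (pd δ Fh) (inv v)) β v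
        = contr (fun ε v => pd ε (pd 0 Fh) (inv v)) β v :=
      contr_congr (ψ := fun δ v => pd 0 (pd δ Fh) (inv v)) (ψ' := fun δ v => pd δ (pd 0 Fh) (inv v))
        (fun δ => pd_comm (hA v hv) 0 δ) β
    rw [← e]
    have e2 : v (Fin.last (n + 1)) * contr (fun δ v => pd 0 (pd δ Fh) (inv v)) β v
        = contr (fun δ v => v (Fin.last (n + 1)) * pd 0 (pd δ Fh) (inv v)) β v := by
      simp only [contr, Finset.mul_sum, mul_assoc]
    rw [e2]
    refine Eq.trans (contr_congr (fun δ => ?_) β) (contr_add_sub _ _ _ _ _ v β)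
    refine (mul_pd_contr hvN (fun ε => hA2 ε δ) γ ν).trans ?_
    congr 2
    exact contr_congr (fun ε => mul_pd_comp_inv hvN
      (analyticAt_pd (analyticAt_pd (hA v hv) δ) ε) ν) γ
  rw [h2, h0, h0] at h1
  refine Eq.trans h1 ?_
  simp only [hessInv]
  ring

/-- Third derivatives of `(v^N)² G`. -/
theorem pd_pd_pd_sq_mul {G : Pt n → ℂ} (hV : IsOpen V) (hG : ∀ v ∈ V, AnalyticAt ℂ G v)
    (κ ν γ β : Fin (n + 2)) : ∀ v ∈ V, pd ν (pd γ (pd β fun v => v κ * (v κ * G v))) v =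
      2 * ((if ν = κ then 1 else 0) * (if γ = κ then 1 else 0) * pd β G v
        + (if ν = κ then 1 else 0) * (if β = κ then 1 else 0) * pd γ G v
        + (if γ = κ then 1 else 0) * (if β = κ then 1 else 0) * pd ν G v)
      + 2 * v κ * ((if ν = κ then 1 else 0) * pd γ (pd β G) v
        + (if γ = κ then 1 else 0) * pd ν (pd β G) v
        + (if β = κ then 1 else 0) * pd ν (pd γ G) v)
      + v κ ^ 2 * pd ν (pd γ (pd β G)) v := by
  have hc : ∀ v : Pt n, AnalyticAt ℂ (fun v : Pt n => v κ) v := analyticAt_coord κ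
  have h1 : ∀ H : Pt n → ℂ, (∀ v ∈ V, AnalyticAt ℂ H v) → ∀ β, ∀ v ∈ V,
      pd β (fun v => v κ * (v κ * H v)) v
        = 2 * (if β = κ then 1 else 0) * (v κ * H v) + v κ * (v κ * pd β H v) := by
    intro H hH β v hv
    rw [pd_coord_mul ((hc v).fun_mul (hH v hv)), pd_coord_mul (hH v hv)]
    ring
  have hG1 : ∀ β, ∀ v ∈ V, AnalyticAt ℂ (pd β G) v := fun β v hv => analyticAt_pd (hG v hv) β
  have h2 : ∀ v ∈ V, pd γ (pd β fun v => v κ * (v κ * G v)) v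
      = 2 * (if β = κ then 1 else 0) * (if γ = κ then 1 else 0) * G v
        + 2 * (if β = κ then 1 else 0) * (v κ * pd γ G v)
        + 2 * (if γ = κ then 1 else 0) * (v κ * pd β G v) + v κ * (v κ * pd γ (pd β G) v) := by
    intro v hv
    rw [pd_congr hV (h1 G hG β) γ v hv,
      pd_add (analyticAt_const.fun_mul ((hc v).fun_mul (hG v hv)))
        ((hc v).fun_mul ((hc v).fun_mul (hG1 β v hv))),
      pd_const_mul, pd_coord_mul (hG v hv), h1 _ (hG1 β) γ v hv]
    ring
  intro v hv
  have a1 := hG1 β v hv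
  have a2 := hG1 γ v hv
  have a3 := analyticAt_pd a1 γ
  have e1 : AnalyticAt ℂ
      (fun v => 2 * (if β = κ then 1 else 0) * (if γ = κ then 1 else 0) * G v) v :=
    analyticAt_const.mul (hG v hv)
  have e2 : AnalyticAt ℂ (fun v => 2 * (if β = κ then 1 else 0) * (v κ * pd γ G v)) v :=
    analyticAt_const.mul ((hc v).mul a2)
  have e3 : AnalyticAt ℂ (fun v => 2 * (if γ = κ then 1 else 0) * (v κ * pd β G v)) v :=
    analyticAt_const.mul ((hc v).mul a1)
  have e4 : AnalyticAt ℂ (fun v => v κ * (v κ * pd γ (pd β G) v)) v :=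
    (hc v).mul ((hc v).mul a3)
  rw [pd_congr hV h2 ν v hv, pd_add ((e1.fun_add e2).fun_add e3) e4,
    pd_add (e1.fun_add e2) e3, pd_add e1 e2, pd_const_mul, pd_const_mul, pd_const_mul,
    pd_coord_mul a2, pd_coord_mul a1, h1 _ (fun v hv => analyticAt_pd (hG1 β v hv) γ) ν v hv]
  ring

/-- The pulled back third derivatives of `F̂` in terms of `G = F̂ ∘ inv`. -/
theorem cubicInv_eq (hV : IsOpen V) (hVN : ∀ v ∈ V, v (Fin.last (n + 1)) ≠ 0)
    (hA : ∀ v ∈ V, AnalyticAt ℂ Fh (inv v)) (ν γ β : Fin (n + 2)) :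
    ∀ v ∈ V, cubicInv Fh ν γ β v = v (Fin.last (n + 1)) *
      (pd ν (pd γ (pd β fun v => v (Fin.last (n + 1)) * (v (Fin.last (n + 1)) * Fh (inv v)))) v
        - (if γ = Fin.rev β then 1 else 0)
          * pd ν (fun v => v (Fin.last (n + 1)) * pd 0 (fun v => Fh (inv v)) v) v
        - (if ν = Fin.rev β then 1 else 0)
          * pd γ (fun v => v (Fin.last (n + 1)) * pd 0 (fun v => Fh (inv v)) v) v
        - (if ν = Fin.rev γ then 1 else 0)
          * pd β (fun v => v (Fin.last (n + 1)) * pd 0 (fun v => Fh (inv v)) v) v) := by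
  intro v hv
  have h1 := mul_pd_hessInv hV hVN hA ν γ β v hv
  have hG' : ∀ v ∈ V, AnalyticAt ℂ (fun v => Fh (inv v)) v :=
    fun v hv => analyticAt_comp_inv (hVN v hv) (hA v hv)
  rw [pd_congr hV (hessInv_eq hV hVN hA γ β) ν v hv, hessInv_eq hV hVN hA ν β v hv,
    hessInv_eq hV hVN hA γ ν v hv] at h1
  rw [pd_pd_pd_sq_mul hV hG' _ ν γ β v hv]
  generalize (fun v => Fh (inv v)) = G at *
  have hG := hG' v hv
  have a : ∀ β, AnalyticAt ℂ (pd β G) v := fun β => analyticAt_pd hG β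
  have a3 := analyticAt_pd (a β) γ
  have hc := analyticAt_coord (Fin.last (n + 1)) v
  have e1 := hc.fun_mul a3
  have e2 : AnalyticAt ℂ (fun v => (if γ = Fin.last (n + 1) then 1 else 0) * pd β G v) v :=
    analyticAt_const.fun_mul (a β)
  have e3 : AnalyticAt ℂ (fun v => (if β = Fin.last (n + 1) then 1 else 0) * pd γ G v) v :=
    analyticAt_const.fun_mul (a γ)
  have e4 : AnalyticAt ℂ (fun v => (if γ = Fin.rev β then 1 else 0) * pd 0 G v) v :=
    analyticAt_const.fun_mul (a 0)
  rw [pd_coord_mul (((e1.fun_add e2).fun_add e3).fun_sub e4), pd_sub ((e1.fun_add e2).fun_add e3) e4,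
    pd_add (e1.fun_add e2) e3, pd_add e1 e2, pd_const_mul, pd_const_mul, pd_const_mul,
    pd_coord_mul a3] at h1
  rw [pd_coord_mul (a 0), pd_coord_mul (a 0), pd_coord_mul (a 0)]
  rw [pd_comm hG γ ν] at h1
  have hs : (if γ = Fin.rev ν then (1 : ℂ) else 0) = if ν = Fin.rev γ then 1 else 0 := by
    simp only [← Fin.rev_eq_iff (i := γ) (j := ν), eq_comm]
  rw [hs] at h1
  linear_combination -h1

end

section
variable {F Fh : Pt n → ℂ} {U : Set (Pt n)}

theorem IsInversion.mul_mul (hinv : IsInversion F Fh U) : ∀ v ∈ regular U,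
    v (Fin.last (n + 1)) * (v (Fin.last (n + 1)) * Fh (inv v))
      = F v - v 0 * (1 / 2 * etaQuad v) := by
  intro v hv
  have := hv.2
  rw [hinv v hv]
  field_simp

theorem pd_coord_mul_half_etaQuad (β : Fin (n + 2)) (v : Pt n) :
    pd β (fun v => v 0 * (1 / 2 * etaQuad v)) v
      = (if β = 0 then 1 else 0) * (1 / 2 * etaQuad v) + v 0 * v (Fin.rev β) := by
  rw [pd_coord_mul (analyticAt_half_etaQuad v), pd_half_etaQuad]

theorem cLow_coord_mul_half_etaQuad (ν γ β : Fin (n + 2)) (v : Pt n) :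
    cLow (fun v => v 0 * (1 / 2 * etaQuad v)) ν γ β v
      = (if β = 0 then 1 else 0) * (if ν = Fin.rev γ then 1 else 0)
        + (if γ = 0 then 1 else 0) * (if ν = Fin.rev β then 1 else 0)
        + (if ν = 0 then 1 else 0) * (if γ = Fin.rev β then 1 else 0) := by
  have h1 : pd β (fun v : Pt n => v 0 * (1 / 2 * etaQuad v))
      = fun v => (if β = 0 then 1 else 0) * (1 / 2 * etaQuad v) + v 0 * v (Fin.rev β) :=
    funext (pd_coord_mul_half_etaQuad β)
  have h2 : pd γ (pd β (fun v : Pt n => v 0 * (1 / 2 * etaQuad v)))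
      = fun v => (if β = 0 then 1 else 0) * v (Fin.rev γ)
        + ((if γ = 0 then 1 else 0) * v (Fin.rev β)
        + (if γ = Fin.rev β then 1 else 0) * v 0) := by
    rw [h1]
    funext v
    rw [pd_add (analyticAt_const.fun_mul (analyticAt_half_etaQuad v))
      ((analyticAt_coord 0 v).fun_mul (analyticAt_coord _ v)), pd_const_mul, pd_half_etaQuad,
      pd_coord_mul (analyticAt_coord _ v), pd_coord]
    ring
  have h3 : cLow (fun v : Pt n => v 0 * (1 / 2 * etaQuad v)) ν γ β
      = pd ν (pd γ (pd β (fun v : Pt n => v 0 * (1 / 2 * etaQuad v)))) := rfl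
  rw [h3, h2, pd_add (analyticAt_const.fun_mul (analyticAt_coord _ v))
    ((analyticAt_const.fun_mul (analyticAt_coord _ v)).fun_add
      (analyticAt_const.fun_mul (analyticAt_coord _ v))),
    pd_add (analyticAt_const.fun_mul (analyticAt_coord _ v))
      (analyticAt_const.fun_mul (analyticAt_coord _ v)), pd_const_mul, pd_const_mul, pd_const_mul,
    pd_coord, pd_coord, pd_coord]
  ring

/-- The function `χ = v^N ∂_1 (F̂ ∘ inv) + v^1`; one has `∂_1 F = ½ η_{αβ} v^α v^β + v^N χ`. -/
noncomputable def chi (Fh : Pt n → ℂ) (v : Pt n) : ℂ :=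
  v (Fin.last (n + 1)) * pd 0 (fun v => Fh (inv v)) v + v 0

theorem pd_chi {v : Pt n} (hv : v (Fin.last (n + 1)) ≠ 0) (hA : AnalyticAt ℂ Fh (inv v))
    (ν : Fin (n + 2)) : pd ν (chi Fh) v
      = pd ν (fun v => v (Fin.last (n + 1)) * pd 0 (fun v => Fh (inv v)) v) v
        + if ν = 0 then 1 else 0 := by
  have := pd_add ((analyticAt_coord (Fin.last (n + 1)) v).fun_mul
    (analyticAt_pd (analyticAt_comp_inv hv hA) 0)) (analyticAt_coord 0 v) ν
  rw [pd_coord] at this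
  exact this

theorem pd_zero_eq (hU : IsOpen U) (hF : AnalyticOnNhd ℂ F U) (hinv : IsInversion F Fh U)
    (hA : ∀ v ∈ regular U, AnalyticAt ℂ Fh (inv v)) :
    ∀ v ∈ regular U, pd 0 F v = 1 / 2 * etaQuad v + v (Fin.last (n + 1)) * chi Fh v := by
  intro v hv
  have hG := analyticAt_comp_inv hv.2 (hA v hv)
  have h := pd_congr (isOpen_regular hU) hinv.mul_mul 0 v hv
  rw [pd_sub (hF v hv.1) ((analyticAt_coord 0 v).fun_mul (analyticAt_half_etaQuad v)),
    pd_coord_mul_half_etaQuad, pd_coord_mul ((analyticAt_coord _ v).fun_mul hG),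
    pd_coord_mul hG, Fin.rev_zero] at h
  have h0 : ¬ (0 : Fin (n + 2)) = Fin.last (n + 1) := Fin.last_pos.ne
  simp only [h0, if_false, if_true] at h
  simp only [chi]
  linear_combination -h

theorem cubicInv_eq_sub (hU : IsOpen U) (hF : AnalyticOnNhd ℂ F U) (hinv : IsInversion F Fh U)
    (hA : ∀ v ∈ regular U, AnalyticAt ℂ Fh (inv v)) (ν γ β : Fin (n + 2)) :
    ∀ v ∈ regular U, cubicInv Fh ν γ β v = v (Fin.last (n + 1)) * (cLow F ν γ β v
        - (if γ = Fin.rev β then 1 else 0) * pd ν (chi Fh) v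
        - (if ν = Fin.rev β then 1 else 0) * pd γ (chi Fh) v
        - (if ν = Fin.rev γ then 1 else 0) * pd β (chi Fh) v) := by
  intro v hv
  have hV := isOpen_regular hU
  rw [cubicInv_eq hV (fun v hv => hv.2) hA ν γ β v hv]
  have hQ : ∀ v : Pt n, AnalyticAt ℂ (fun v : Pt n => v 0 * (1 / 2 * etaQuad v)) v :=
    fun v => (analyticAt_coord 0 v).fun_mul (analyticAt_half_etaQuad v)
  have h1 : ∀ v ∈ regular U, pd β (fun v => v (Fin.last (n + 1)) * (v (Fin.last (n + 1))
      * Fh (inv v))) v = pd β F v - pd β (fun v => v 0 * (1 / 2 * etaQuad v)) v := fun v hv => by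
    rw [pd_congr hV hinv.mul_mul β v hv, pd_sub (hF v hv.1) (hQ v)]
  have h2 : ∀ v ∈ regular U, pd γ (pd β (fun v => v (Fin.last (n + 1)) * (v (Fin.last (n + 1))
      * Fh (inv v)))) v
      = pd γ (pd β F) v - pd γ (pd β (fun v => v 0 * (1 / 2 * etaQuad v))) v := fun v hv => by
    rw [pd_congr hV h1 γ v hv,
      pd_sub (analyticAt_pd (hF v hv.1) β) (analyticAt_pd (hQ v) β)]
  rw [pd_congr hV h2 ν v hv,
    pd_sub (analyticAt_pd (analyticAt_pd (hF v hv.1) β) γ)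
      (analyticAt_pd (analyticAt_pd (hQ v) β) γ)]
  have h3 := cLow_coord_mul_half_etaQuad ν γ β v
  simp only [cLow] at h3 ⊢
  rw [h3, pd_chi hv.2 (hA v hv), pd_chi hv.2 (hA v hv), pd_chi hv.2 (hA v hv)]
  ring

theorem cubicInv_zero_left (hFh : IsSolution Fh (inv '' regular U)) (γ β : Fin (n + 2)) :
    ∀ v ∈ regular U, cubicInv Fh 0 γ β v
      = v (Fin.last (n + 1)) * if β = Fin.rev γ then 1 else 0 := by
  intro v hv
  rw [← sum_scaledJac_mul_scaledJac hv.2 γ β, Finset.mul_sum]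
  have h1 : ∀ δ, contr (fun ε => contr (fun ζ v => cLow Fh ζ ε δ (inv v)) 0) γ v
      = v (Fin.last (n + 1)) * scaledJac (Fin.rev δ) γ v := by
    intro δ
    have h2 : ∀ ε, contr (fun ζ v => cLow Fh ζ ε δ (inv v)) 0 v
        = v (Fin.last (n + 1)) * if ε = Fin.rev δ then 1 else 0 := by
      intro ε
      rw [contr_zero, hFh.metric _ ⟨v, hv, rfl⟩, eta]
      simp only [← Fin.rev_eq_iff (i := δ) (j := ε), eq_comm]
    have h3 : contr (fun ε => contr (fun ζ v => cLow Fh ζ ε δ (inv v)) 0) γ v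
      = ∑ ε, contr (fun ζ v => cLow Fh ζ ε δ (inv v)) 0 v * scaledJac ε γ v := rfl
    rw [h3]
    simp [h2]
  have h4 : cubicInv Fh 0 γ β v
      = ∑ δ, contr (fun ε => contr (fun ζ v => cLow Fh ζ ε δ (inv v)) 0) γ v
        * scaledJac δ β v := rfl
  rw [h4, ← Equiv.sum_comp Fin.revPerm]
  simp [h1, mul_assoc]

/-- The condition that `F̂` has the same metric `η` forces `χ` to be locally constant. -/
theorem pd_chi_eq_zero (hF : IsSolution F U) (hinv : IsInversion F Fh U)
    (hFh : IsSolution Fh (inv '' regular U)) (ν : Fin (n + 2)) :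
    ∀ v ∈ regular U, pd ν (chi Fh) v = 0 := by
  intro v hv
  have hA : ∀ v ∈ regular U, AnalyticAt ℂ Fh (inv v) :=
    fun v hv => hFh.analytic _ ⟨v, hv, rfl⟩
  have h0 : ¬ (0 : Fin (n + 2)) = Fin.last (n + 1) := Fin.last_pos.ne
  have key : ∀ γ β, (if γ = Fin.rev β then 1 else 0) * pd 0 (chi Fh) v
        + (if β = Fin.last (n + 1) then 1 else 0) * pd γ (chi Fh) v
        + (if γ = Fin.last (n + 1) then 1 else 0) * pd β (chi Fh) v = 0 := by
    intro γ β
    have h1 := cubicInv_eq_sub hF.isOpen hF.analytic hinv hA 0 γ β v hv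
    rw [cubicInv_zero_left hFh γ β v hv, hF.metric v hv.1, eta] at h1
    have h2 := mul_left_cancel₀ hv.2 h1
    have e : ∀ β : Fin (n + 2), (0 = Fin.rev β) ↔ β = Fin.last (n + 1) := fun β => by
      rw [eq_comm, rev_eq_zero_iff]
    simp only [e] at h2
    linear_combination h2
  have k0 : pd 0 (chi Fh) v = 0 := by
    have := key 0 (Fin.last (n + 1))
    simp only [Fin.rev_last, if_true, h0, if_false] at this
    linear_combination this / 2
  have k1 := key ν (Fin.last (n + 1))
  by_cases h : ν = Fin.last (n + 1)
  · subst h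
    simp only [k0, if_true] at k1
    linear_combination k1 / 2
  · simp only [k0, h, if_true, if_false] at k1
    linear_combination k1

/-- The multiplication is preserved by the inversion: in terms of the Jacobian matrix `J`,
`ĉ_{ζεδ} J^ζ_ν J^ε_γ J^δ_β = (v^N)⁻² c_{νγβ}`. -/
theorem cubicInv_eq_cLow (hF : IsSolution F U) (hinv : IsInversion F Fh U)
    (hFh : IsSolution Fh (inv '' regular U)) (ν γ β : Fin (n + 2)) :
    ∀ v ∈ regular U, cubicInv Fh ν γ β v = v (Fin.last (n + 1)) * cLow F ν γ β v := by
  intro v hv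
  rw [cubicInv_eq_sub hF.isOpen hF.analytic hinv (fun v hv => hFh.analytic _ ⟨v, hv, rfl⟩)
    ν γ β v hv]
  simp only [pd_chi_eq_zero hF hinv hFh _ v hv, mul_zero, sub_zero]

/-- The law of transformation of the structure constants with two indices raised. -/
theorem sum_cUp_mul_scaledJac (hF : IsSolution F U) (hinv : IsInversion F Fh U)
    (hFh : IsSolution Fh (inv '' regular U)) (α δ ε : Fin (n + 2)) :
    ∀ v ∈ regular U, v (Fin.last (n + 1)) *
      ∑ γ, ∑ β, scaledJac α γ v * scaledJac δ β v * cUp F γ β ε v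
        = ∑ ζ, cUp Fh α δ ζ (inv v) * scaledJac ζ ε v := by
  intro v hv
  have hlin : ∀ (a : Fin (n + 2) → ℂ) (ψ : Fin (n + 2) → Fin (n + 2) → Pt n → ℂ) (ε : Fin (n + 2)),
      ∑ β, a β * contr (ψ β) ε v = contr (fun δ v => ∑ β, a β * ψ β δ v) ε v := by
    intro a ψ ε
    simp only [contr, Finset.mul_sum, Finset.sum_mul]
    rw [Finset.sum_comm]
    exact Finset.sum_congr rfl fun _ _ => Finset.sum_congr rfl fun _ _ => by ring
  have hrev : ∀ (ψ : Fin (n + 2) → Pt n → ℂ) (δ : Fin (n + 2)),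
      ∑ β, scaledJac δ β v * contr ψ (Fin.rev β) v = ψ (Fin.rev δ) v := by
    intro ψ δ
    simp only [contr, Finset.mul_sum]
    rw [Finset.sum_comm]
    have : ∀ κ, ∑ β, scaledJac δ β v * (ψ κ v * scaledJac κ (Fin.rev β) v)
        = ψ κ v * if κ = Fin.rev δ then 1 else 0 := fun κ => by
      rw [← sum_scaledJac_mul_scaledJac_rev hv.2 δ κ, Finset.mul_sum]
      exact Finset.sum_congr rfl fun _ _ => by ring
    simp [this]
  have h1 : ∀ γ, ∑ β, scaledJac δ β v * cubicInv Fh (Fin.rev β) γ ε v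
      = contr (fun δ' => contr (fun ε' v => cLow Fh (Fin.rev δ) ε' δ' (inv v)) γ) ε v := by
    intro γ
    refine (hlin (fun β => scaledJac δ β v) (fun β δ' =>
      contr (fun ε' => contr (fun ζ v => cLow Fh ζ ε' δ' (inv v)) (Fin.rev β)) γ) ε).trans ?_
    refine contr_congr (fun δ' => ?_) ε
    refine (hlin (fun β => scaledJac δ β v) (fun β ε' =>
      contr (fun ζ v => cLow Fh ζ ε' δ' (inv v)) (Fin.rev β)) γ).trans ?_
    exact contr_congr (fun ε' => hrev (fun ζ v => cLow Fh ζ ε' δ' (inv v)) δ) γ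
  have h2 : ∑ γ, scaledJac α γ v * contr (fun δ' =>
        contr (fun ε' v => cLow Fh (Fin.rev δ) ε' δ' (inv v)) (Fin.rev γ)) ε v
      = contr (fun δ' v => cLow Fh (Fin.rev δ) (Fin.rev α) δ' (inv v)) ε v := by
    refine (hlin (fun γ => scaledJac α γ v) (fun γ δ' =>
      contr (fun ε' v => cLow Fh (Fin.rev δ) ε' δ' (inv v)) (Fin.rev γ)) ε).trans ?_
    exact contr_congr (fun δ' => hrev (fun ε' v => cLow Fh (Fin.rev δ) ε' δ' (inv v)) α) ε
  simp only [cUp_eq]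
  refine Eq.trans ?_ h2
  rw [Finset.mul_sum]
  refine Finset.sum_congr rfl fun γ _ => ?_
  rw [← h1, Finset.mul_sum, Finset.mul_sum]
  refine Finset.sum_congr rfl fun β _ => ?_
  rw [cubicInv_eq_cLow hF hinv hFh _ _ _ v hv]
  ring

end

/-! ### Conformality of the inverted solution -/

theorem pd_euler {q : Fin (n + 2) → ℂ} {φ : Fin (n + 2) → Pt n → ℂ} {v : Pt n}
    (hφ : ∀ α, AnalyticAt ℂ (φ α) v) (β : Fin (n + 2)) :
    pd β (fun v => ∑ α, q α * v α * φ α v) v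
      = q β * φ β v + ∑ α, q α * v α * pd β (φ α) v := by
  have h : ∀ α, pd β (fun v => q α * v α * φ α v) v
      = (if β = α then q α * φ α v else 0) + q α * v α * pd β (φ α) v := by
    intro α
    simp only [mul_assoc]
    rw [pd_const_mul, pd_coord_mul (hφ α)]
    split_ifs <;> ring
  rw [pd_sum (f := fun α v => q α * v α * φ α v) _
    fun α => (analyticAt_const.mul (analyticAt_coord α v)).mul (hφ α)]
  simp only [h, Finset.sum_add_distrib]
  simp

theorem analyticAt_euler {q : Fin (n + 2) → ℂ} {φ : Fin (n + 2) → Pt n → ℂ} {v : Pt n}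
    (hφ : ∀ α, AnalyticAt ℂ (φ α) v) :
    AnalyticAt ℂ (fun v => ∑ α, q α * v α * φ α v) v :=
  analyticAt_sum (f := fun α v => q α * v α * φ α v) _
    fun α => (analyticAt_const.fun_mul (analyticAt_coord α v)).fun_mul (hφ α)

theorem pd_linear (b : Fin (n + 2) → ℂ) (β : Fin (n + 2)) (v : Pt n) :
    pd β (fun v => ∑ α, b α * v α) v = b β := by
  rw [pd_sum (f := fun α v => b α * v α) _
    fun α => analyticAt_const.fun_mul (analyticAt_coord α v)]
  simp [pd_const_mul, pd_coord]

theorem analyticAt_linear (b : Fin (n + 2) → ℂ) (v : Pt n) :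
    AnalyticAt ℂ (fun v : Pt n => ∑ α, b α * v α) v :=
  analyticAt_sum (f := fun α v => b α * v α) _
    fun α => analyticAt_const.fun_mul (analyticAt_coord α v)

theorem pd_quadratic (A : Fin (n + 2) → Fin (n + 2) → ℂ) (β : Fin (n + 2)) (v : Pt n) :
    pd β (fun v => ∑ α, ∑ γ, A α γ * v α * v γ) v = ∑ α, (A β α + A α β) * v α := by
  have e : (fun v : Pt n => ∑ α, ∑ γ, A α γ * v α * v γ)
      = fun v => ∑ α, 1 * v α * ∑ γ, A α γ * v γ := by
    funext v
    simp only [Finset.mul_sum]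
    exact Finset.sum_congr rfl fun _ _ => Finset.sum_congr rfl fun _ _ => by ring
  rw [e, pd_euler (q := fun _ => 1) (φ := fun α v => ∑ γ, A α γ * v γ)
    fun α => analyticAt_linear _ v]
  simp only [pd_linear, add_mul, Finset.sum_add_distrib, one_mul]
  congr 1
  exact Finset.sum_congr rfl fun _ _ => mul_comm _ _

theorem analyticAt_quadratic (A : Fin (n + 2) → Fin (n + 2) → ℂ) (v : Pt n) :
    AnalyticAt ℂ (fun v : Pt n => ∑ α, ∑ γ, A α γ * v α * v γ) v :=
  analyticAt_sum (f := fun α v => ∑ γ, A α γ * v α * v γ) _ fun α =>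
    analyticAt_sum (f := fun γ v => A α γ * v α * v γ) _ fun γ =>
      (analyticAt_const.fun_mul (analyticAt_coord α v)).fun_mul (analyticAt_coord γ v)

section
variable {F Fh : Pt n → ℂ} {U : Set (Pt n)} {k C : ℂ} {q B : Fin (n + 2) → ℂ}
  {A : Fin (n + 2) → Fin (n + 2) → ℂ}

/-- The first derivatives of a quasihomogeneity equation. -/
theorem euler_pd (hU : IsOpen U) (hF : AnalyticOnNhd ℂ F U)
    (hE : ∀ v ∈ U, ∑ α, q α * v α * pd α F v =
        k * F v + 1 / 2 * ∑ α, ∑ β, A α β * v α * v β + ∑ α, B α * v α + C) (β : Fin (n + 2)) :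
    ∀ v ∈ U, q β * pd β F v + ∑ α, q α * v α * pd β (pd α F) v
      = k * pd β F v + 1 / 2 * (∑ α, (A β α + A α β) * v α) + B β := by
  intro v hv
  rw [← pd_euler (fun α => analyticAt_pd (hF v hv) α), pd_congr hU hE β v hv]
  have a1 : AnalyticAt ℂ (fun v => k * F v) v := analyticAt_const.fun_mul (hF v hv)
  have a2 : AnalyticAt ℂ (fun v : Pt n => 1 / 2 * ∑ α, ∑ γ, A α γ * v α * v γ) v :=
    analyticAt_const.fun_mul (analyticAt_quadratic A v)
  rw [pd_add ((a1.fun_add a2).fun_add (analyticAt_linear B v)) analyticAt_const,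
    pd_add (a1.fun_add a2) (analyticAt_linear B v), pd_add a1 a2, pd_const_mul, pd_const_mul,
    pd_quadratic, pd_linear, pd_const]
  ring

/-- The second derivatives of a quasihomogeneity equation. -/
theorem euler_pd_pd (hU : IsOpen U) (hF : AnalyticOnNhd ℂ F U)
    (hE : ∀ v ∈ U, ∑ α, q α * v α * pd α F v =
        k * F v + 1 / 2 * ∑ α, ∑ β, A α β * v α * v β + ∑ α, B α * v α + C)
    (β γ : Fin (n + 2)) :
    ∀ v ∈ U, (q β + q γ) * pd γ (pd β F) v + ∑ α, q α * v α * cLow F γ β α v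
      = k * pd γ (pd β F) v + 1 / 2 * (A β γ + A γ β) := by
  intro v hv
  have h := pd_congr hU (euler_pd hU hF hE β) γ v hv
  have a0 := hF v hv
  have a1 : AnalyticAt ℂ (fun v => k * pd β F v) v :=
    analyticAt_const.fun_mul (analyticAt_pd a0 β)
  have a2 : AnalyticAt ℂ (fun v : Pt n => 1 / 2 * ∑ α, (A β α + A α β) * v α) v :=
    analyticAt_const.fun_mul (analyticAt_linear _ v)
  have a3 : AnalyticAt ℂ (fun v => q β * pd β F v) v :=
    analyticAt_const.fun_mul (analyticAt_pd a0 β)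
  have a4 : ∀ α, AnalyticAt ℂ (pd β (pd α F)) v := fun α => analyticAt_pd (analyticAt_pd a0 α) β
  rw [pd_add a3 (analyticAt_euler a4), pd_euler a4, pd_add (a1.fun_add a2) analyticAt_const,
    pd_add a1 a2, pd_const_mul, pd_const_mul, pd_const_mul, pd_linear, pd_const,
    pd_comm a0 β γ] at h
  simp only [cLow]
  linear_combination h

/-- In a conformal solution the weights of dual coordinates add up to `2 - d`. -/
theorem weight_add_weight_rev (hF : IsSolution F U) (hU : U.Nonempty)
    (hE : ∀ v ∈ U, ∑ α, q α * v α * pd α F v =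
        k * F v + 1 / 2 * ∑ α, ∑ β, A α β * v α * v β + ∑ α, B α * v α + C) (γ : Fin (n + 2)) :
    q γ + q (Fin.rev γ) = k - q 0 := by
  obtain ⟨v, hv⟩ := hU
  have h1 : ∀ v ∈ U, (q 0 + q γ) * pd γ (pd 0 F) v + q (Fin.rev γ) * v (Fin.rev γ)
      = k * pd γ (pd 0 F) v + 1 / 2 * (A 0 γ + A γ 0) := by
    intro v hv
    rw [← euler_pd_pd hF.isOpen hF.analytic hE 0 γ v hv]
    simp [hF.cLow_zero_mid hv]
  have h2 := pd_congr hF.isOpen h1 (Fin.rev γ) v hv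
  have a := analyticAt_pd (analyticAt_pd (hF.analytic v hv) 0) γ
  rw [pd_add (analyticAt_const.fun_mul a) (analyticAt_const.fun_mul (analyticAt_coord _ v)),
    pd_add (analyticAt_const.fun_mul a) analyticAt_const, pd_const_mul, pd_const_mul, pd_const_mul,
    pd_coord, pd_const] at h2
  have h3 : pd (Fin.rev γ) (pd γ (pd 0 F)) v = 1 := by
    have := hF.cLow_zero_right hv (Fin.rev γ) γ
    rwa [if_pos (Fin.rev_rev γ).symm] at this
  rw [h3, if_pos rfl] at h2
  linear_combination h2

/-- For an invertible conformal solution, the quadratic polynomial in the quasihomogeneity equation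
does not contain `v^1`, except in the product `v^1 v^N`. -/
theorem quadratic_terms_zero (hF : IsSolution F U) (hinv : IsInversion F Fh U)
    (hFh : IsSolution Fh (inv '' regular U))
    (hE : ∀ v ∈ U, ∑ α, q α * v α * pd α F v =
        k * F v + 1 / 2 * ∑ α, ∑ β, A α β * v α * v β + ∑ α, B α * v α + C)
    (hV : (regular U).Nonempty) :
    (∀ γ, γ ≠ Fin.last (n + 1) → A 0 γ + A γ 0 = 0) ∧ B 0 = 0 := by
  obtain ⟨v, hv⟩ := hV
  have hA : ∀ v ∈ regular U, AnalyticAt ℂ Fh (inv v) :=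
    fun v hv => hFh.analytic _ ⟨v, hv, rfl⟩
  have hq := weight_add_weight_rev hF ⟨v, hv.1⟩ hE
  have h0 := pd_zero_eq hF.isOpen hF.analytic hinv hA
  have h1 : ∀ γ, pd γ (pd 0 F) v
      = v (Fin.rev γ) + (if γ = Fin.last (n + 1) then 1 else 0) * chi Fh v := by
    intro γ
    have hc : AnalyticAt ℂ (chi Fh) v :=
      ((analyticAt_coord _ v).fun_mul (analyticAt_pd (analyticAt_comp_inv hv.2 (hA v hv)) 0)).fun_add
        (analyticAt_coord 0 v)
    rw [pd_congr (isOpen_regular hF.isOpen) h0 γ v hv,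
      pd_add (analyticAt_half_etaQuad v) ((analyticAt_coord _ v).fun_mul hc), pd_half_etaQuad,
      pd_coord_mul hc, pd_chi_eq_zero hF hinv hFh γ v hv]
    ring
  have hqN : q (Fin.last (n + 1)) = k - 2 * q 0 := by
    have := hq 0
    rw [Fin.rev_zero] at this
    linear_combination this
  have h2 : ∀ γ, 1 / 2 * (A 0 γ + A γ 0)
      = -(q 0 * ((if γ = Fin.last (n + 1) then 1 else 0) * chi Fh v)) := by
    intro γ
    have := euler_pd_pd hF.isOpen hF.analytic hE 0 γ v hv.1
    simp only [hF.cLow_zero_mid hv.1, mul_ite, mul_one, mul_zero, Finset.sum_ite_eq',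
      Finset.mem_univ, if_true] at this
    rw [h1] at this
    by_cases hγ : γ = Fin.last (n + 1)
    · simp only [hγ, if_true, hqN] at this ⊢
      have h' := hq (Fin.last (n + 1))
      rw [hqN] at h'
      linear_combination -this + v (Fin.rev (Fin.last (n + 1))) * h'
    · simp only [hγ, if_false] at this ⊢
      linear_combination -this + v (Fin.rev γ) * hq γ
  refine ⟨fun γ hγ => ?_, ?_⟩
  · have := h2 γ
    simp only [hγ, if_false] at this
    linear_combination 2 * this
  · have h3 := euler_pd hF.isOpen hF.analytic hE 0 v hv.1
    have h4 : ∑ α, q α * v α * pd 0 (pd α F) v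
        = (k - q 0) * (1 / 2 * etaQuad v)
          + q (Fin.last (n + 1)) * v (Fin.last (n + 1)) * chi Fh v := by
      have e : ∀ α, q α * v α * pd 0 (pd α F) v = v (Fin.rev α) * (q α * v α)
          + if α = Fin.last (n + 1) then q α * v α * chi Fh v else 0 := by
        intro α
        rw [pd_comm (hF.analytic v hv.1), h1]
        split_ifs <;> ring
      simp only [e, Finset.sum_add_distrib, Finset.sum_ite_eq', Finset.mem_univ, if_true]
      rw [sum_rev_mul_weight hq]
    have h5 : 1 / 2 * ∑ α, (A 0 α + A α 0) * v α
        = -(q 0 * chi Fh v * v (Fin.last (n + 1))) := by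
      rw [Finset.mul_sum]
      have e : ∀ α, 1 / 2 * ((A 0 α + A α 0) * v α)
          = if α = Fin.last (n + 1) then -(q 0 * chi Fh v * v α) else 0 := by
        intro α
        rw [← mul_assoc, h2]
        split_ifs <;> ring
      simp only [e, Finset.sum_ite_eq', Finset.mem_univ, if_true]
    rw [h4, h5, h0 v hv, hqN] at h3
    linear_combination -h3

end

/-- Polynomial functions of degree at most two, in the form used in `IsConformal`. -/
def IsQuadratic (f : Pt n → ℂ) : Prop :=
  ∃ (A : Fin (n + 2) → Fin (n + 2) → ℂ) (B : Fin (n + 2) → ℂ) (C : ℂ), ∀ w,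
    f w = 1 / 2 * ∑ α, ∑ β, A α β * w α * w β + ∑ α, B α * w α + C

namespace IsQuadratic

theorem add {f g : Pt n → ℂ} (hf : IsQuadratic f) (hg : IsQuadratic g) :
    IsQuadratic fun w => f w + g w := by
  obtain ⟨A, B, C, h⟩ := hf
  obtain ⟨A', B', C', h'⟩ := hg
  refine ⟨fun α β => A α β + A' α β, fun α => B α + B' α, C + C', fun w => ?_⟩
  simp only [h, h', add_mul, Finset.sum_add_distrib]
  ring

theorem const_mul (c : ℂ) {f : Pt n → ℂ} (hf : IsQuadratic f) : IsQuadratic fun w => c * f w := by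
  obtain ⟨A, B, C, h⟩ := hf
  refine ⟨fun α β => c * A α β, fun α => c * B α, c * C, fun w => ?_⟩
  simp only [h, mul_add, Finset.mul_sum]
  congr 2
  · exact Finset.sum_congr rfl fun _ _ => Finset.sum_congr rfl fun _ _ => by ring
  · exact Finset.sum_congr rfl fun _ _ => by ring

theorem const (c : ℂ) : IsQuadratic fun _ : Pt n => c :=
  ⟨0, 0, c, fun w => by simp⟩

theorem sum {ι : Type*} (s : Finset ι) {f : ι → Pt n → ℂ} (hf : ∀ i, IsQuadratic (f i)) :
    IsQuadratic fun w => ∑ i ∈ s, f i w := by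
  classical
  induction s using Finset.induction_on with
  | empty => simpa using const 0
  | insert i s hi ih => simpa only [Finset.sum_insert hi] using (hf i).add ih

theorem affine_mul_affine (a b : Fin (n + 2) → ℂ) (a₀ b₀ : ℂ) :
    IsQuadratic fun w => (∑ α, a α * w α + a₀) * (∑ α, b α * w α + b₀) := by
  refine ⟨fun α β => 2 * (a α * b β), fun α => a₀ * b α + b₀ * a α, a₀ * b₀, fun w => ?_⟩
  have h1 : (∑ α, a α * w α) * ∑ α, b α * w α
      = 1 / 2 * ∑ α, ∑ β, 2 * (a α * b β) * w α * w β := by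
    rw [Finset.sum_mul_sum, Finset.mul_sum]
    refine Finset.sum_congr rfl fun _ _ => ?_
    rw [Finset.mul_sum]
    exact Finset.sum_congr rfl fun _ _ => by ring
  have h2 : ∑ α, (a₀ * b α + b₀ * a α) * w α = a₀ * ∑ α, b α * w α + b₀ * ∑ α, a α * w α := by
    rw [Finset.mul_sum, Finset.mul_sum, ← Finset.sum_add_distrib]
    exact Finset.sum_congr rfl fun _ _ => by ring
  rw [← h1, h2]
  ring

theorem etaQuad : IsQuadratic (etaQuad (n := n)) :=
  ⟨fun α β => 2 * eta α β, 0, 0, fun w => by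
    simp only [WDVV.etaQuad, mul_assoc, ← Finset.mul_sum]
    simp⟩

end IsQuadratic

theorem etaQuad_inv {v : Pt n} (hv : v (Fin.last (n + 1)) ≠ 0) :
    v (Fin.last (n + 1)) ^ 2 * etaQuad (inv v) = -2 * (v 0 * v (Fin.last (n + 1))) := by
  have h0N : (0 : Fin (n + 2)) ≠ Fin.last (n + 1) := Fin.last_pos.ne
  have h0 := mul_inv_zero hv
  -- `v^N v̂^α = v^α` except for the first and the last index
  have h : ∀ α, v (Fin.last (n + 1)) * inv v α = v α
      + ((if α = 0 then 1 / 2 * etaQuad v - v 0 else 0)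
        + if α = Fin.last (n + 1) then -1 - v (Fin.last (n + 1)) else 0) := by
    intro α
    by_cases hα0 : α = 0
    · simp only [hα0, h0N, if_true, if_false, h0]; ring
    · by_cases hαN : α = Fin.last (n + 1)
      · simp only [hαN, h0N.symm, if_true, if_false, mul_inv_last hv]; ring
      · simp only [hα0, hαN, if_false, mul_inv_mid hv hα0 hαN]; ring
  have e : v (Fin.last (n + 1)) ^ 2 * etaQuad (inv v)
      = ∑ α, (v (Fin.last (n + 1)) * inv v α) * (v (Fin.last (n + 1)) * inv v (Fin.rev α)) := by
    rw [etaQuad_eq, Finset.mul_sum]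
    exact Finset.sum_congr rfl fun _ _ => by ring
  rw [e]
  simp only [h, rev_eq_zero_iff, rev_eq_last_iff, mul_add, add_mul, Finset.sum_add_distrib]
  rw [← etaQuad_eq]
  simp only [mul_ite, ite_mul, mul_zero, zero_mul, Finset.sum_ite_eq', Finset.mem_univ, if_true,
    Fin.rev_zero, Fin.rev_last, h0N, h0N.symm, if_false]
  ring

/-- Quadratic polynomials in `v` in which `v^1` occurs only in the product `v^1 v^N` are taken by
the inversion to `(v^N)²` times a quadratic polynomial in `v̂`. -/
theorem exists_isQuadratic_inv {A : Fin (n + 2) → Fin (n + 2) → ℂ} {B : Fin (n + 2) → ℂ} (C : ℂ)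
    (hA : ∀ γ, γ ≠ Fin.last (n + 1) → A 0 γ + A γ 0 = 0) (hB : B 0 = 0) :
    ∃ φ : Pt n → ℂ, IsQuadratic φ ∧ ∀ v : Pt n, v (Fin.last (n + 1)) ≠ 0 →
      1 / 2 * ∑ α, ∑ β, A α β * v α * v β + ∑ α, B α * v α + C
        = v (Fin.last (n + 1)) ^ 2 * φ (inv v) := by
  have h0N : (0 : Fin (n + 2)) ≠ Fin.last (n + 1) := Fin.last_pos.ne
  -- `z_α` is `v^α / v^N` as an affine function of `v̂`, for `α ≠ 1`
  let z : Fin (n + 2) → Pt n → ℂ := fun α w =>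
    if α = 0 then 0 else if α = Fin.last (n + 1) then 1 else w α
  have hz : ∀ α, ∃ (a : Fin (n + 2) → ℂ) (a₀ : ℂ), z α = fun w => ∑ γ, a γ * w γ + a₀ := by
    intro α
    by_cases h1 : α = 0
    · exact ⟨0, 0, by funext w; simp [z, h1]⟩
    · by_cases h2 : α = Fin.last (n + 1)
      · exact ⟨0, 1, by funext w; simp [z, h2]⟩
      · exact ⟨Pi.single α 1, 0, by funext w; simp [z, h1, h2, Pi.single_apply]⟩
  have hN : ∃ (a : Fin (n + 2) → ℂ) (a₀ : ℂ),
      (fun w : Pt n => w (Fin.last (n + 1))) = fun w => ∑ γ, a γ * w γ + a₀ :=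
    ⟨Pi.single (Fin.last (n + 1)) 1, 0, by funext w; simp [Pi.single_apply]⟩
  have hmul : ∀ f g : Pt n → ℂ,
      (∃ (a : Fin (n + 2) → ℂ) (a₀ : ℂ), f = fun w => ∑ γ, a γ * w γ + a₀) →
      (∃ (a : Fin (n + 2) → ℂ) (a₀ : ℂ), g = fun w => ∑ γ, a γ * w γ + a₀) →
      IsQuadratic fun w => f w * g w := by
    rintro _ _ ⟨a, a₀, rfl⟩ ⟨b, b₀, rfl⟩
    exact IsQuadratic.affine_mul_affine a b a₀ b₀
  refine ⟨fun w => 1 / 2 * (∑ α, ∑ β, A α β * (z α w * z β w))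
      + (-1 / 4 * (A 0 (Fin.last (n + 1)) + A (Fin.last (n + 1)) 0)) * etaQuad w
      + ∑ α, (-B α) * (z α w * w (Fin.last (n + 1)))
      + C * (w (Fin.last (n + 1)) * w (Fin.last (n + 1))), ?_, ?_⟩
  · refine IsQuadratic.add (IsQuadratic.add (IsQuadratic.add ?_ ?_) ?_) ?_
    · exact IsQuadratic.const_mul _ (IsQuadratic.sum _ fun α => IsQuadratic.sum _ fun β =>
        IsQuadratic.const_mul _ (hmul _ _ (hz α) (hz β)))
    · exact IsQuadratic.const_mul _ IsQuadratic.etaQuad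
    · exact IsQuadratic.sum _ fun α => IsQuadratic.const_mul _ (hmul _ _ (hz α) hN)
    · exact IsQuadratic.const_mul _ (hmul _ _ hN hN)
  · intro v hv
    have hvz : ∀ α, v α = v (Fin.last (n + 1)) * z α (inv v) + if α = 0 then v 0 else 0 := by
      intro α
      by_cases h1 : α = 0
      · simp [z, h1]
      · by_cases h2 : α = Fin.last (n + 1)
        · simp [z, h2, h0N.symm]
        · simp [z, h1, h2, mul_inv_mid hv h1 h2]
    have hzN : z (Fin.last (n + 1)) (inv v) = 1 := by simp [z, h0N.symm]
    have hwN := mul_inv_last hv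
    have hQ := etaQuad_inv hv
    have hB' : ∑ α, B α * v α = v (Fin.last (n + 1)) * ∑ α, B α * z α (inv v) := by
      rw [Finset.mul_sum]
      refine Finset.sum_congr rfl fun α _ => ?_
      rw [hvz α]
      by_cases h1 : α = 0
      · simp [h1, hB]
      · simp [h1]; ring
    have hA0 : ∑ β, (A 0 β + A β 0) * z β (inv v)
        = A 0 (Fin.last (n + 1)) + A (Fin.last (n + 1)) 0 := by
      rw [Finset.sum_eq_single (Fin.last (n + 1)), hzN, mul_one]
      · intro β _ hβ
        rw [hA β hβ, zero_mul]
      · simp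
    have hA00 : A 0 0 = 0 := by linear_combination 1 / 2 * hA 0 h0N
    have hA' : ∑ α, ∑ β, A α β * v α * v β
        = v (Fin.last (n + 1)) ^ 2 * ∑ α, ∑ β, A α β * (z α (inv v) * z β (inv v))
          + v 0 * v (Fin.last (n + 1)) * ∑ β, (A 0 β + A β 0) * z β (inv v) := by
      have e : ∀ α β, A α β * v α * v β
          = v (Fin.last (n + 1)) ^ 2 * (A α β * (z α (inv v) * z β (inv v)))
            + (if α = 0 then v 0 * v (Fin.last (n + 1)) * (A α β * z β (inv v)) else 0)
            + (if β = 0 then v 0 * v (Fin.last (n + 1)) * (A α β * z α (inv v)) else 0) := by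
        intro α β
        rw [hvz α, hvz β]
        by_cases h1 : α = 0 <;> by_cases h2 : β = 0
        · simp [h1, h2, hA00]
        · simp only [h1, h2, z, if_true, if_false]; ring
        · simp only [h1, h2, z, if_true, if_false]; ring
        · simp [h1, h2]; ring
      simp only [e, Finset.sum_add_distrib, ← Finset.mul_sum, add_mul, mul_add]
      rw [Finset.sum_comm (f := fun α β => if α = 0 then _ else _)]
      simp only [Finset.sum_ite_eq', Finset.mem_univ, if_true, ← Finset.mul_sum]
      ring
    have hB'' : ∑ α, (-B α) * (z α (inv v) * inv v (Fin.last (n + 1)))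
        = -inv v (Fin.last (n + 1)) * ∑ α, B α * z α (inv v) := by
      rw [Finset.mul_sum]
      exact Finset.sum_congr rfl fun _ _ => by ring
    simp only [hB'']
    rw [hA', hA0, hB']
    linear_combination
      (1 / 4 * (A 0 (Fin.last (n + 1)) + A (Fin.last (n + 1)) 0)) * hQ
        + (v (Fin.last (n + 1)) * ∑ α, B α * z α (inv v)) * hwN
        - C * (v (Fin.last (n + 1)) * inv v (Fin.last (n + 1)) - 1) * hwN

section
variable {F Fh : Pt n → ℂ} {U : Set (Pt n)} {d : ℂ} {μ : Fin (n + 2) → ℂ}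

theorem IsConformal.spectrum_add_rev (hF : IsSolution F U) (hU : U.Nonempty)
    (hconf : IsConformal F U d μ) (α : Fin (n + 2)) : μ α + μ (Fin.rev α) = 0 := by
  obtain ⟨h0, A, B, C, hE⟩ := hconf
  have := weight_add_weight_rev (q := fun α => 1 - d / 2 - μ α) hF hU hE α
  simp only [h0] at this
  linear_combination -this

theorem IsConformal.spectrum_last (hF : IsSolution F U) (hU : U.Nonempty)
    (hconf : IsConformal F U d μ) : μ (Fin.last (n + 1)) = d / 2 := by
  have := hconf.spectrum_add_rev hF hU 0
  rw [Fin.rev_zero, hconf.1] at this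
  linear_combination this

theorem IsConformal.weight_inv (hF : IsSolution F U) (hU : U.Nonempty)
    (hconf : IsConformal F U d μ) (δ : Fin (n + 2)) :
    1 - chargeInv d / 2 - spectrumInv μ δ =
      (if δ = 0 then 2 - d else if δ = Fin.last (n + 1) then 0 else 1 - d / 2 - μ δ)
        - (1 - d / 2 - μ (Fin.last (n + 1))) := by
  have hN := hconf.spectrum_last hF hU
  have h0 := hconf.1
  simp only [chargeInv, spectrumInv]
  split_ifs
  · rw [hN]; ring
  · rw [hN, h0]; ring
  · rw [hN]; ring

/-- The Jacobian matrix of the inversion takes the Euler vector field to the one with the inverted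
charge and spectrum. -/
theorem IsConformal.sum_scaledJac_mul_euler (hF : IsSolution F U) (hU : U.Nonempty)
    (hconf : IsConformal F U d μ) {v : Pt n} (hv : v (Fin.last (n + 1)) ≠ 0) (δ : Fin (n + 2)) :
    ∑ β, scaledJac δ β v * ((1 - d / 2 - μ β) * v β) =
      v (Fin.last (n + 1)) * ((1 - chargeInv d / 2 - spectrumInv μ δ) * inv v δ) := by
  rw [hconf.weight_inv hF hU]
  exact WDVV.sum_scaledJac_mul_euler hv (c := 2 - d) (q := fun α => 1 - d / 2 - μ α)
    (fun α => by linear_combination -hconf.spectrum_add_rev hF hU α) δ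

/-- Conformality of the inverted solution.  By
`IsConformal.sum_scaledJac_mul_euler`, the Euler vector field of `v̂` applied to `F̂` is that of `v` applied to
`F̂ ∘ inv`, and the inhomogeneous term is quadratic in `v̂` by
`exists_isQuadratic_inv`. -/
theorem IsConformal.inversion (hF : IsSolution F U) (hU : U.Nonempty)
    (hconf : IsConformal F U d μ) (hinv : IsInversion F Fh U)
    (hFh : IsSolution Fh (inv '' regular U)) :
    IsConformal Fh (inv '' regular U) (chargeInv d) (spectrumInv μ) := by
  have hN := hconf.spectrum_last hF hU
  have hsum := fun {v : Pt n} (hv : v (Fin.last (n + 1)) ≠ 0) =>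
    hconf.sum_scaledJac_mul_euler hF hU hv
  have hrev := hconf.spectrum_add_rev hF hU
  obtain ⟨h0, A, B, C, hE⟩ := hconf
  refine ⟨by simp only [spectrumInv, chargeInv, if_true, hN]; ring, ?_⟩
  rcases (regular U).eq_empty_or_nonempty with hV | hV
  · exact ⟨0, 0, 0, by simp [hV]⟩
  obtain ⟨hA0, hB0⟩ := quadratic_terms_zero (q := fun α => 1 - d / 2 - μ α) hF hinv hFh hE hV
  obtain ⟨φ, ⟨A', B', C', hφ⟩, hφv⟩ := exists_isQuadratic_inv C hA0 hB0
  refine ⟨A', B', C', ?_⟩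
  rintro _ ⟨v, hv, rfl⟩
  have hvN := hv.2
  have hA : AnalyticAt ℂ Fh (inv v) := hFh.analytic _ ⟨v, hv, rfl⟩
  have hG := analyticAt_comp_inv hvN hA
  -- the Euler vector field of `v̂`, applied to `F̂`, is that of `v` applied to `F̂ ∘ inv`
  have h1 : ∑ α, (1 - chargeInv d / 2 - spectrumInv μ α) * inv v α * pd α Fh (inv v)
      = ∑ β, (1 - d / 2 - μ β) * v β * pd β (fun v => Fh (inv v)) v := by
    refine mul_left_cancel₀ hvN ?_
    rw [Finset.mul_sum, Finset.mul_sum]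
    have e1 : ∀ α, v (Fin.last (n + 1)) * ((1 - chargeInv d / 2 - spectrumInv μ α) * inv v α
          * pd α Fh (inv v))
        = ∑ β, scaledJac α β v * ((1 - d / 2 - μ β) * v β) * pd α Fh (inv v) := by
      intro α
      rw [← Finset.sum_mul, hsum hvN]
      ring
    have e2 : ∀ β, v (Fin.last (n + 1)) * ((1 - d / 2 - μ β) * v β
          * pd β (fun v => Fh (inv v)) v)
        = ∑ α, scaledJac α β v * ((1 - d / 2 - μ β) * v β) * pd α Fh (inv v) := by
      intro β
      rw [mul_left_comm, mul_pd_comp_inv hvN hA, contr, Finset.mul_sum]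
      exact Finset.sum_congr rfl fun _ _ => by ring
    simp only [e1, e2]
    exact Finset.sum_comm
  have h2 : ∀ β, pd β F v = (if β = 0 then 1 else 0) * (1 / 2 * etaQuad v) + v 0 * v (Fin.rev β)
      + ((if β = Fin.last (n + 1) then 1 else 0) * (v (Fin.last (n + 1)) * Fh (inv v))
        + v (Fin.last (n + 1)) * ((if β = Fin.last (n + 1) then 1 else 0) * Fh (inv v)
        + v (Fin.last (n + 1)) * pd β (fun v => Fh (inv v)) v)) := by
    intro β
    have h := pd_congr (isOpen_regular hF.isOpen) hinv.mul_mul β v hv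
    rw [pd_sub (hF.analytic v hv.1)
      ((analyticAt_coord 0 v).fun_mul (analyticAt_half_etaQuad v)),
      pd_coord_mul_half_etaQuad, pd_coord_mul ((analyticAt_coord _ v).fun_mul hG),
      pd_coord_mul hG] at h
    linear_combination -h
  have h3 : ∑ β, (1 - d / 2 - μ β) * v β * pd β F v
      = (3 - d) * (v 0 * (1 / 2 * etaQuad v))
        + 2 * (1 - d) * v (Fin.last (n + 1)) ^ 2 * Fh (inv v)
        + v (Fin.last (n + 1)) ^ 2
          * ∑ β, (1 - d / 2 - μ β) * v β * pd β (fun v => Fh (inv v)) v := by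
    have hw := sum_rev_mul_weight (c := 2 - d) (q := fun α => 1 - d / 2 - μ α)
      (fun α => by linear_combination -hrev α) v
    have e : ∀ β, (1 - d / 2 - μ β) * v β * pd β F v
        = (if β = 0 then (1 - d / 2 - μ β) * v β * (1 / 2 * etaQuad v) else 0)
          + v 0 * (v (Fin.rev β) * ((1 - d / 2 - μ β) * v β))
          + (if β = Fin.last (n + 1) then (1 - d / 2 - μ β) * v β
            * (2 * v (Fin.last (n + 1)) * Fh (inv v)) else 0)
          + v (Fin.last (n + 1)) ^ 2
            * ((1 - d / 2 - μ β) * v β * pd β (fun v => Fh (inv v)) v) := by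
      intro β
      rw [h2 β]
      split_ifs <;> ring
    simp only [e, Finset.sum_add_distrib, ← Finset.mul_sum, Finset.sum_ite_eq', Finset.mem_univ,
      if_true]
    rw [hw, hN, h0]
    ring
  have h4 := hE v hv.1
  rw [h3, add_assoc ((3 - d) * F v), add_assoc ((3 - d) * F v), hφv v hvN] at h4
  have h5 := hinv.mul_mul v hv
  rw [h1, add_assoc ((3 - chargeInv d) * _), add_assoc ((3 - chargeInv d) * _), ← hφ]
  refine mul_left_cancel₀ (pow_ne_zero 2 hvN) ?_
  simp only [chargeInv]
  linear_combination h4 - (3 - d) * h5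

end

/-! ### Differential polynomials -/

/-- Differential functions that are, on the jets of curves in `V`, polynomials in the jet variables
with coefficients analytic on `V`.  On these, the total derivative is a derivation. -/
inductive IsDiffPoly (V : Set (Pt n)) : DiffFun n → Prop
  | ofPt {f : Pt n → ℂ} (hf : ∀ v ∈ V, AnalyticAt ℂ f v) : IsDiffPoly V (ofPt f)
  | jet (k : ℕ) (α : Fin (n + 2)) : IsDiffPoly V fun u => u k α
  | add {f g : DiffFun n} (hf : IsDiffPoly V f) (hg : IsDiffPoly V g) : IsDiffPoly V (f + g)
  | mul {f g : DiffFun n} (hf : IsDiffPoly V f) (hg : IsDiffPoly V g) : IsDiffPoly V (f * g)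
  | congr {f g : DiffFun n} (hf : IsDiffPoly V f) (h : ∀ u : Jet n, u 0 ∈ V → f u = g u) :
      IsDiffPoly V g

section
variable {V : Set (Pt n)}

theorem eventually_jet_mem (hV : IsOpen V) {u : Jet n} (hu : u 0 ∈ V) (w : Jet n) :
    ∀ᶠ t : ℂ in 𝓝 0, (u + t • w) 0 ∈ V := by
  have hc : ContinuousAt (fun t : ℂ => u 0 + t • w 0) 0 := by fun_prop
  exact hc.eventually_mem (by simpa using hV.mem_nhds hu)

theorem Dx_congr (hV : IsOpen V) {f g : DiffFun n} (h : ∀ u : Jet n, u 0 ∈ V → f u = g u) :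
    ∀ u : Jet n, u 0 ∈ V → Dx f u = Dx g u := by
  intro u hu
  have : (fun t : ℂ => f (u + t • fun k => u (k + 1))) =ᶠ[𝓝 0]
      fun t : ℂ => g (u + t • fun k => u (k + 1)) :=
    (eventually_jet_mem hV hu _).mono fun t ht => h _ ht
  exact this.deriv_eq

theorem IsDiffPoly.lineDifferentiableAt (hV : IsOpen V) {f : DiffFun n} (hf : IsDiffPoly V f)
    {u : Jet n} (hu : u 0 ∈ V) (w : Jet n) : LineDifferentiableAt ℂ f u w := by
  induction hf with
  | ofPt hf => exact (hf _ hu).differentiableAt.lineDifferentiableAt (v := w 0)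
  | jet k α =>
    have : DifferentiableAt ℂ (fun t : ℂ => u k α + t * w k α) 0 := by fun_prop
    exact this
  | add _ _ ihf ihg => exact DifferentiableAt.add ihf ihg
  | mul _ _ ihf ihg => exact DifferentiableAt.mul ihf ihg
  | congr _ h ih =>
    exact DifferentiableAt.congr_of_eventuallyEq ih
      ((eventually_jet_mem hV hu w).mono fun t ht => (h _ ht).symm)

theorem Dx_ofPt {f : Pt n → ℂ} {u : Jet n} (hf : AnalyticAt ℂ f (u 0)) :
    Dx (ofPt f) u = ∑ α, pd α f (u 0) * u 1 α :=
  (hf.differentiableAt.lineDeriv_eq_fderiv (v := u 1)).trans (fderiv_apply_eq_sum_pd _ _)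

theorem Dx_jet (k : ℕ) (α : Fin (n + 2)) :
    Dx (fun u : Jet n => u k α) = fun u => u (k + 1) α := by
  funext u
  have : HasDerivAt (fun t : ℂ => u k α + t * u (k + 1) α) (u (k + 1) α) 0 := by
    simpa using ((hasDerivAt_id (0 : ℂ)).mul_const (u (k + 1) α)).const_add (u k α)
  exact this.deriv

theorem Dx_add (hV : IsOpen V) {f g : DiffFun n} (hf : IsDiffPoly V f) (hg : IsDiffPoly V g)
    {u : Jet n} (hu : u 0 ∈ V) : Dx (f + g) u = Dx f u + Dx g u :=
  deriv_add (hf.lineDifferentiableAt hV hu _) (hg.lineDifferentiableAt hV hu _)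

theorem Dx_mul (hV : IsOpen V) {f g : DiffFun n} (hf : IsDiffPoly V f) (hg : IsDiffPoly V g)
    {u : Jet n} (hu : u 0 ∈ V) : Dx (f * g) u = Dx f u * g u + f u * Dx g u := by
  have := deriv_mul (hf.lineDifferentiableAt hV hu fun k => u (k + 1))
    (hg.lineDifferentiableAt hV hu fun k => u (k + 1))
  simp only [zero_smul, add_zero] at this
  exact this

theorem Dx_smul (c : ℂ) (f : DiffFun n) : Dx (c • f) = c • Dx f := by
  funext u
  exact deriv_const_mul_field c

namespace IsDiffPoly

theorem const (c : ℂ) : IsDiffPoly V fun _ => c :=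
  ofPt (f := fun _ => c) fun _ _ => analyticAt_const

theorem smul (c : ℂ) {f : DiffFun n} (hf : IsDiffPoly V f) : IsDiffPoly V (c • f) :=
  (const c).mul hf

theorem sum {ι : Type*} (s : Finset ι) {f : ι → DiffFun n} (hf : ∀ i ∈ s, IsDiffPoly V (f i)) :
    IsDiffPoly V (∑ i ∈ s, f i) := by
  classical
  induction s using Finset.induction_on with
  | empty => exact const 0
  | insert i s hi ih =>
    rw [Finset.sum_insert hi]
    exact (hf i (Finset.mem_insert_self _ _)).add
      (ih fun j hj => hf j (Finset.mem_insert_of_mem hj))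

theorem Dx (hV : IsOpen V) {f : DiffFun n} (hf : IsDiffPoly V f) : IsDiffPoly V (Dx f) := by
  induction hf with
  | @ofPt f hf =>
    have h : IsDiffPoly V (∑ α, (WDVV.ofPt (pd α f)) * fun u : Jet n => u 1 α) :=
      sum _ fun α _ => (ofPt fun v hv => analyticAt_pd (hf v hv) α).mul (jet 1 α)
    refine h.congr fun u hu => ?_
    rw [Dx_ofPt (hf _ hu), Finset.sum_apply]
    rfl
  | jet k α =>
    rw [Dx_jet]
    exact jet (k + 1) α
  | add hf hg ihf ihg => exact (ihf.add ihg).congr fun u hu => (Dx_add hV hf hg hu).symm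
  | mul hf hg ihf ihg =>
    exact ((ihf.mul hg).add (hf.mul ihg)).congr fun u hu => (Dx_mul hV hf hg hu).symm
  | congr _ h ih => exact ih.congr (Dx_congr hV h)

theorem Dx_iterate (hV : IsOpen V) {f : DiffFun n} (hf : IsDiffPoly V f) (k : ℕ) :
    IsDiffPoly V (WDVV.Dx^[k] f) := by
  induction k with
  | zero => exact hf
  | succ k ih =>
    rw [Function.iterate_succ_apply']
    exact ih.Dx hV

end IsDiffPoly

theorem Dx_sum (hV : IsOpen V) {ι : Type*} (s : Finset ι) {f : ι → DiffFun n}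
    (hf : ∀ i ∈ s, IsDiffPoly V (f i)) {u : Jet n} (hu : u 0 ∈ V) :
    Dx (∑ i ∈ s, f i) u = ∑ i ∈ s, Dx (f i) u := by
  classical
  induction s using Finset.induction_on with
  | empty => simp [Dx_zero]
  | insert i s hi ih =>
    have h1 : ∀ j ∈ s, IsDiffPoly V (f j) := fun j hj => hf j (Finset.mem_insert_of_mem hj)
    rw [Finset.sum_insert hi, Finset.sum_insert hi,
      Dx_add hV (hf i (Finset.mem_insert_self _ _)) (IsDiffPoly.sum s h1) hu, ih h1]

end

/-! ### Coefficients of compositions -/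

theorem comp_apply_eq_sum (a b : PsiDO n) (m : ℤ) (s : Finset (ℤ × ℕ))
    (h : ∀ p ∉ s, a.1 p.1 = 0 ∨ Ring.choose p.1 p.2 = 0 ∨ b.1 (m - p.1 + p.2) = 0) :
    (comp a b).1 m = ∑ p ∈ s,
      (Ring.choose p.1 p.2 : ℤ) • (a.1 p.1 * Dx^[p.2] (b.1 (m - p.1 + p.2))) := by
  refine finsum_eq_sum_of_support_subset _ fun p hp => ?_
  by_contra hps
  refine hp ?_
  rcases h p hps with h | h | h
  · simp [h]
  · simp [h]
  · simp [h, Dx_iterate_zero]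

theorem choose_neg_one (k : ℕ) : Ring.choose (-1 : ℤ) k = (-1) ^ k := by
  rw [Ring.choose_neg]
  have : (1 : ℤ) + k - 1 = (k : ℤ) := by ring
  rw [this, Ring.choose_natCast]
  simp [Units.smul_def, Int.coe_negOnePow_natCast]

theorem mono_apply (f : DiffFun n) (k m : ℤ) : (mono f k).1 m = if m = k then f else 0 := by
  simp [mono, Pi.single_apply]

theorem add_coe_apply (a b : PsiDO n) (m : ℤ) : (a + b).1 m = a.1 m + b.1 m := rfl

theorem sub_coe_apply (a b : PsiDO n) (m : ℤ) : (a - b).1 m = a.1 m - b.1 m := rfl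

theorem sum_coe_apply {ι : Type*} (s : Finset ι) (a : ι → PsiDO n) (m : ℤ) :
    (∑ i ∈ s, a i).1 m = ∑ i ∈ s, (a i).1 m := by
  have h : ((∑ i ∈ s, a i : PsiDO n) : ℤ → DiffFun n) = ∑ i ∈ s, (a i : ℤ → DiffFun n) :=
    AddSubgroup.val_finsetSum _ _ _
  rw [h, Finset.sum_apply]

/-- Left composition with a differential operator of order one. -/
theorem comp_first_order_apply (f g : DiffFun n) (b : PsiDO n) (m : ℤ) :
    (comp (mono f 1 + mono g 0) b).1 m = f * b.1 (m - 1) + f * Dx (b.1 m) + g * b.1 m := by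
  rw [comp_apply_eq_sum _ _ _ {(1, 0), (1, 1), (0, 0)}]
  · rw [Finset.sum_insert (by simp), Finset.sum_insert (by simp), Finset.sum_singleton]
    simp [add_coe_apply, mono_apply]
    ring
  · rintro ⟨i, k⟩ hp
    simp only [Finset.mem_insert, Finset.mem_singleton, Prod.mk.injEq, not_or, not_and] at hp
    by_cases h1 : i = 1
    · subst h1
      refine Or.inr (Or.inl ?_)
      have : Ring.choose ((1 : ℕ) : ℤ) k = ((Nat.choose 1 k : ℕ) : ℤ) := Ring.choose_natCast _ _
      have h2 : 1 < k := by
        have := hp.1; have := hp.2.1; grind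
      rw [Nat.choose_eq_zero_of_lt h2] at this
      exact_mod_cast this
    · by_cases h0 : i = 0
      · subst h0
        exact Or.inr (Or.inl (Ring.choose_zero_pos ℤ (Nat.pos_of_ne_zero (hp.2.2 rfl))))
      · left
        simp [add_coe_apply, mono_apply, h1, h0]

/-- The coefficients of `f ∂⁻¹ ∘ g = ∑_j (-1)^j f (∂^j g) ∂^{-1-j}`. -/
theorem comp_integral_apply (f g : DiffFun n) (j : ℕ) :
    (comp (mono f (-1)) (mono g 0)).1 (-1 - j) = (-1 : ℂ) ^ j • (f * Dx^[j] g) := by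
  rw [comp_apply_eq_sum _ _ _ {(-1, j)}]
  · rw [Finset.sum_singleton]
    have e : (-1 : ℤ) - j - -1 + j = 0 := by ring
    simp only [mono_apply, choose_neg_one, e, if_true]
    funext u
    simp
  · rintro ⟨i, k⟩ hp
    simp only [Finset.mem_singleton, Prod.mk.injEq, not_and] at hp
    by_cases h1 : i = -1
    · subst h1
      have := hp rfl
      refine Or.inr (Or.inr ?_)
      rw [mono_apply, if_neg]
      dsimp only
      omega
    · left
      simp [mono_apply, h1]

theorem comp_integral_apply_nonneg (f g : DiffFun n) {m : ℤ} (hm : 0 ≤ m) :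
    (comp (mono f (-1)) (mono g 0)).1 m = 0 := by
  rw [comp_apply_eq_sum _ _ _ ∅]
  · simp
  · rintro ⟨i, k⟩ _
    by_cases h1 : i = -1
    · subst h1
      refine Or.inr (Or.inr ?_)
      rw [mono_apply, if_neg]
      dsimp only
      omega
    · left
      simp [mono_apply, h1]

/-- Left composition with `f - a ∂⁻¹`. -/
theorem comp_sub_integral_apply (f a : DiffFun n) (b : PsiDO n) (m : ℤ) (K : ℕ)
    (hb : ∀ j, m + 1 + K ≤ j → b.1 j = 0) :
    (comp (mono f 0 - mono a (-1)) b).1 m = f * b.1 m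
      - a * ∑ k ∈ Finset.range K, (-1 : ℂ) ^ k • Dx^[k] (b.1 (m + 1 + k)) := by
  have hinj : Function.Injective fun k : ℕ => ((-1 : ℤ), k) := fun _ _ h => (Prod.mk.inj h).2
  rw [comp_apply_eq_sum _ _ _ (insert (0, 0) ((Finset.range K).map ⟨_, hinj⟩))]
  · rw [Finset.sum_insert (by simp), Finset.sum_map, sub_eq_add_neg (f * _), Finset.mul_sum,
      ← Finset.sum_neg_distrib]
    congr 1
    · simp [sub_coe_apply, mono_apply]
    · refine Finset.sum_congr rfl fun k _ => ?_
      simp [sub_coe_apply, mono_apply, choose_neg_one]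
      funext u
      simp
  · rintro ⟨i, k⟩ hp
    simp only [Finset.mem_insert, Finset.mem_map, Finset.mem_range, Function.Embedding.coeFn_mk,
      Prod.mk.injEq, not_or, not_and, not_exists] at hp
    by_cases h1 : i = -1
    · subst h1
      refine Or.inr (Or.inr (hb _ ?_))
      dsimp only
      have : ¬ k < K := fun hk => hp.2 k hk rfl rfl
      omega
    · by_cases h0 : i = 0
      · subst h0
        exact Or.inr (Or.inl (Ring.choose_zero_pos ℤ (Nat.pos_of_ne_zero (hp.1 rfl))))
      · left
        simp [sub_coe_apply, mono_apply, h1, h0]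

/-! ### The action of the reciprocal transformation on operators of order one -/

/-- The matrix differential operator `g^{αβ} ∂_x + h^{αβ}`. -/
noncomputable def firstOrder (g h : Fin (n + 2) → Fin (n + 2) → DiffFun n) : MatOp n :=
  fun α β => mono (g α β) 1 + mono (h α β) 0

/-- The differential function `v^N ∂v̂^δ/∂v^β`. -/
noncomputable def jacF (β δ : Fin (n + 2)) : DiffFun n :=
  ofPt fun v => theta10 v * pd β (fun v' => inv v' δ) v

/-- The differential function `v̂^δ_x`. -/
noncomputable def velF (δ : Fin (n + 2)) : DiffFun n := Dx (ofPt fun v => inv v δ)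

theorem pd_theta10 (β : Fin (n + 2)) :
    pd β (theta10 : Pt n → ℂ) = fun _ => if β = Fin.last (n + 1) then 1 else 0 := by
  funext v
  rw [theta10_eq, pd_coord]

theorem linOpAdj_zero (β δ : Fin (n + 2)) :
    (linOpAdj theta10 inv β δ).1 0 = jacF β δ := by
  simp only [linOpAdj, add_coe_apply, comp_integral_apply_nonneg _ _ le_rfl, mono_apply, if_true,
    add_zero]
  rfl

theorem linOpAdj_pos (β δ : Fin (n + 2)) {m : ℤ} (hm : 0 < m) :
    (linOpAdj theta10 inv β δ).1 m = 0 := by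
  simp only [linOpAdj, add_coe_apply, comp_integral_apply_nonneg _ _ hm.le, mono_apply,
    if_neg hm.ne', add_zero]

theorem linOpAdj_neg (β δ : Fin (n + 2)) (j : ℕ) :
    (linOpAdj theta10 inv β δ).1 (-1 - j)
      = (-1 : ℂ) ^ j • if β = Fin.last (n + 1) then Dx^[j] (velF δ) else 0 := by
  have h : ¬ (-1 - j : ℤ) = 0 := by omega
  simp only [linOpAdj, add_coe_apply, comp_integral_apply, mono_apply, if_neg h, zero_add,
    pd_theta10]
  congr 1
  split_ifs
  · funext u
    simp [ofPt, velF]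
  · funext u
    simp [ofPt]

section
variable (g h : Fin (n + 2) → Fin (n + 2) → DiffFun n)

theorem firstOrder_comp_apply (Q : MatOp n) (γ δ : Fin (n + 2)) (m : ℤ) :
    ((firstOrder g h).comp Q γ δ).1 m
      = ∑ β, (g γ β * (Q β δ).1 (m - 1) + g γ β * Dx ((Q β δ).1 m) + h γ β * (Q β δ).1 m) := by
  rw [MatOp.comp, sum_coe_apply]
  exact Finset.sum_congr rfl fun β _ => comp_first_order_apply _ _ _ _

theorem firstOrder_comp_linOpAdj_of_gt (γ δ : Fin (n + 2)) {m : ℤ} (hm : 1 < m) :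
    ((firstOrder g h).comp (linOpAdj theta10 inv) γ δ).1 m = 0 := by
  rw [firstOrder_comp_apply]
  refine Finset.sum_eq_zero fun β _ => ?_
  rw [linOpAdj_pos _ _ (by omega), linOpAdj_pos _ _ (by omega), Dx_zero]
  simp

theorem firstOrder_comp_linOpAdj_one (γ δ : Fin (n + 2)) :
    ((firstOrder g h).comp (linOpAdj theta10 inv) γ δ).1 1 = ∑ β, g γ β * jacF β δ := by
  rw [firstOrder_comp_apply]
  refine Finset.sum_congr rfl fun β _ => ?_
  rw [linOpAdj_pos _ _ one_pos, sub_self, linOpAdj_zero, Dx_zero]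
  simp

theorem firstOrder_comp_linOpAdj_zero (γ δ : Fin (n + 2)) :
    ((firstOrder g h).comp (linOpAdj theta10 inv) γ δ).1 0
      = ∑ β, (g γ β * Dx (jacF β δ) + h γ β * jacF β δ) + g γ (Fin.last (n + 1)) * velF δ := by
  rw [firstOrder_comp_apply]
  have h1 : ∀ β, (linOpAdj theta10 inv β δ).1 ((0 : ℤ) - 1)
      = if β = Fin.last (n + 1) then velF δ else 0 := by
    intro β
    have := linOpAdj_neg β δ 0
    simpa using this
  simp only [h1, linOpAdj_zero, mul_ite, mul_zero, add_assoc, Finset.sum_add_distrib,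
    Finset.sum_ite_eq', Finset.mem_univ, if_true]
  ring

/-- The nonlocal part of `P ∘ L*` contains only the zeroth order part of `P`: the terms with `g`
cancel because `∂_x ∘ ∂_x⁻¹ = 1`. -/
theorem firstOrder_comp_linOpAdj_neg (γ δ : Fin (n + 2)) (j : ℕ) :
    ((firstOrder g h).comp (linOpAdj theta10 inv) γ δ).1 (-1 - j)
      = (-1 : ℂ) ^ j • (h γ (Fin.last (n + 1)) * Dx^[j] (velF δ)) := by
  rw [firstOrder_comp_apply]
  have e : (-1 - j - 1 : ℤ) = -1 - (j + 1 : ℕ) := by push_cast; ring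
  simp only [e, linOpAdj_neg, Dx_smul]
  rw [Finset.sum_eq_single (Fin.last (n + 1))]
  · simp only [if_true, Function.iterate_succ_apply']
    funext u
    simp only [Pi.add_apply, Pi.mul_apply, Pi.smul_apply, smul_eq_mul]
    ring
  · intro β _ hβ
    simp [hβ, Dx_zero]
  · simp

/-- The coefficients of `Φ(P)`, given a bound for the order of `P ∘ L*`. -/
theorem Phi_apply (P : MatOp n) (α δ : Fin (n + 2)) (m : ℤ) (K : ℕ)
    (hK : ∀ γ j, m + 1 + K ≤ j → (P.comp (linOpAdj theta10 inv) γ δ).1 j = 0) :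
    (Phi P α δ).1 m
      = ∑ γ, ofPt (pd γ fun v => inv v α) * (P.comp (linOpAdj theta10 inv) γ δ).1 m
        - ofPt (fun v => (theta10 v)⁻¹) * velF α * ∑ k ∈ Finset.range K, (-1 : ℂ) ^ k •
          Dx^[k] ((P.comp (linOpAdj theta10 inv) (Fin.last (n + 1)) δ).1 (m + 1 + k)) := by
  have hL : ∀ γ, linOp theta10 inv α γ = mono (ofPt (pd γ fun v => inv v α)) 0
      - mono (if γ = Fin.last (n + 1) then ofPt (fun v => (theta10 v)⁻¹) * velF α else 0) (-1) := by
    intro γ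
    rw [linOp]
    congr 1
    refine Subtype.ext (funext fun m => ?_)
    rcases lt_or_ge m 0 with hm | hm
    · obtain ⟨j, rfl⟩ : ∃ j : ℕ, m = -1 - j := ⟨(-1 - m).toNat, by omega⟩
      rw [comp_integral_apply, mono_apply, pd_theta10]
      rcases j with _ | j
      · funext u
        by_cases hγ : γ = Fin.last (n + 1) <;> simp [hγ, ofPt, velF]
      · have h0 : ¬ (-1 - (j + 1 : ℕ) : ℤ) = -1 := by push_cast; omega
        -- `∂ρ/∂v^γ` is constant, so that its derivatives vanish
        have h1 : ∀ c : ℂ, Dx (ofPt (fun _ : Pt n => c)) = 0 := fun c => by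
          funext u
          simp [Dx, ofPt, lineDeriv]
        rw [if_neg h0, Function.iterate_succ_apply, h1, Dx_iterate_zero]
        simp
    · rw [comp_integral_apply_nonneg _ _ hm, mono_apply, if_neg (by omega)]
  have h2 : ∀ γ, (comp (linOp theta10 inv α γ) (P.comp (linOpAdj theta10 inv) γ δ)).1 m
      = ofPt (pd γ fun v => inv v α) * (P.comp (linOpAdj theta10 inv) γ δ).1 m
        - if γ = Fin.last (n + 1) then ofPt (fun v => (theta10 v)⁻¹) * velF α
          * ∑ k ∈ Finset.range K, (-1 : ℂ) ^ k •
            Dx^[k] ((P.comp (linOpAdj theta10 inv) γ δ).1 (m + 1 + k)) else 0 := by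
    intro γ
    rw [hL, comp_sub_integral_apply _ _ _ _ K (hK γ)]
    split_ifs <;> simp
  rw [Phi, reciprocal, MatOp.comp, sum_coe_apply]
  simp only [h2, Finset.sum_sub_distrib, Finset.sum_ite_eq', Finset.mem_univ, if_true]

theorem Phi_firstOrder_of_gt (α δ : Fin (n + 2)) {m : ℤ} (hm : 1 < m) :
    (Phi (firstOrder g h) α δ).1 m = 0 := by
  rw [Phi_apply _ _ _ _ 0 fun γ j hj => firstOrder_comp_linOpAdj_of_gt g h γ δ (by
    push_cast at hj; omega)]
  simp [firstOrder_comp_linOpAdj_of_gt g h _ δ hm]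

theorem Phi_firstOrder_one (α δ : Fin (n + 2)) :
    (Phi (firstOrder g h) α δ).1 1
      = ∑ γ, ofPt (pd γ fun v => inv v α) * ∑ β, g γ β * jacF β δ := by
  rw [Phi_apply _ _ _ _ 0 fun γ j hj => firstOrder_comp_linOpAdj_of_gt g h γ δ (by
    push_cast at hj; omega)]
  simp [firstOrder_comp_linOpAdj_one]

theorem Phi_firstOrder_zero (α δ : Fin (n + 2)) :
    (Phi (firstOrder g h) α δ).1 0
      = ∑ γ, ofPt (pd γ fun v => inv v α) *
          (∑ β, (g γ β * Dx (jacF β δ) + h γ β * jacF β δ) + g γ (Fin.last (n + 1)) * velF δ)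
        - ofPt (fun v => (theta10 v)⁻¹) * velF α * ∑ β, g (Fin.last (n + 1)) β * jacF β δ := by
  rw [Phi_apply _ _ _ _ 1 fun γ j hj => firstOrder_comp_linOpAdj_of_gt g h γ δ (by
    push_cast at hj; omega)]
  simp [firstOrder_comp_linOpAdj_one, firstOrder_comp_linOpAdj_zero]

variable {g h} {V : Set (Pt n)}

/-- Criterion for `Φ(P)` to be local.  With `R = P ∘ L*`, the hypothesis `hR` says that the
coefficient of `∂_x⁻¹` in `∂_x⁻¹ ∘ R^N` is `s v^N v̂_x`; the lower coefficients are then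
`(-1)^j s v^N ∂_x^j v̂_x` by induction, and cancel those of `(∂v̂/∂v) R`. -/
theorem Phi_firstOrder_neg (hV : IsOpen V) (hVN : ∀ v ∈ V, v (Fin.last (n + 1)) ≠ 0)
    (hg : ∀ β, IsDiffPoly V (g (Fin.last (n + 1)) β))
    (hh : ∀ β, IsDiffPoly V (h (Fin.last (n + 1)) β)) (s : ℂ) (α δ : Fin (n + 2))
    (hR : ∀ u : Jet n, u 0 ∈ V →
      ((firstOrder g h).comp (linOpAdj theta10 inv) (Fin.last (n + 1)) δ).1 0 u
        - Dx (((firstOrder g h).comp (linOpAdj theta10 inv) (Fin.last (n + 1)) δ).1 1) u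
        = s * (theta10 (u 0) * velF δ u))
    (hN : ∀ u : Jet n, u 0 ∈ V →
      h (Fin.last (n + 1)) (Fin.last (n + 1)) u = s * Dx (ofPt theta10) u)
    (hA : ∀ u : Jet n, u 0 ∈ V →
      ∑ γ, pd γ (fun v => inv v α) (u 0) * h γ (Fin.last (n + 1)) u = s * velF α u)
    (k : ℤ) (hk : k < 0) (u : Jet n) (hu : u 0 ∈ V) :
    (Phi (firstOrder g h) α δ).1 k u = 0 := by
  have hinv : ∀ δ, IsDiffPoly V (ofPt fun v => inv v δ) := fun δ =>
    IsDiffPoly.ofPt fun v hv => analyticAt_inv (hVN v hv) δ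
  have hb : ∀ j, IsDiffPoly V (Dx^[j] (velF δ)) := fun j => ((hinv δ).Dx hV).Dx_iterate hV j
  have hth : IsDiffPoly V (ofPt (theta10 : Pt n → ℂ)) := by
    rw [theta10_eq]
    exact IsDiffPoly.ofPt fun v _ => analyticAt_coord _ v
  have hjac : ∀ β, IsDiffPoly V (jacF β δ) := fun β => by
    refine IsDiffPoly.ofPt fun v hv => ?_
    rw [theta10_eq]
    exact (analyticAt_coord _ v).fun_mul (analyticAt_pd (analyticAt_inv (hVN v hv) δ) β)
  set R : ℤ → DiffFun n := fun m =>
    ((firstOrder g h).comp (linOpAdj theta10 inv) (Fin.last (n + 1)) δ).1 m with hRdef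
  have hR1 : IsDiffPoly V (R 1) := by
    simp only [hRdef]
    rw [firstOrder_comp_linOpAdj_one]
    exact IsDiffPoly.sum _ fun β _ => (hg β).mul (hjac β)
  have hR0 : IsDiffPoly V (R 0) := by
    simp only [hRdef]
    rw [firstOrder_comp_linOpAdj_zero]
    exact (IsDiffPoly.sum _ fun β _ => ((hg β).mul ((hjac β).Dx hV)).add
      ((hh β).mul (hjac β))).add ((hg _).mul (hb 0))
  have hRneg : ∀ j : ℕ, R (-1 - j)
      = (-1 : ℂ) ^ j • (h (Fin.last (n + 1)) (Fin.last (n + 1)) * Dx^[j] (velF δ)) :=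
    fun j => firstOrder_comp_linOpAdj_neg g h _ δ j
  have hRpoly : ∀ m : ℤ, m ≤ 1 → IsDiffPoly V (R m) := by
    intro m hm
    by_cases h1 : m = 1
    · exact h1 ▸ hR1
    · by_cases h0 : m = 0
      · exact h0 ▸ hR0
      · obtain ⟨j, rfl⟩ : ∃ j : ℕ, m = -1 - j := ⟨(-1 - m).toNat, by omega⟩
        rw [hRneg]
        exact ((hh _).mul (hb j)).smul _
  -- the coefficients of `∂_x⁻¹ ∘ R`
  have hS : ∀ j : ℕ, ∀ u : Jet n, u 0 ∈ V →
      (∑ k ∈ Finset.range (j + 2), (-1 : ℂ) ^ k • Dx^[k] (R (k - j))) u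
        = (-1) ^ j * s * (theta10 (u 0) * Dx^[j] (velF δ) u) := by
    intro j
    induction j with
    | zero =>
      intro u hu
      have := hR u hu
      change R 0 u - Dx (R 1) u = _ at this
      simp [Finset.sum_range_succ]
      linear_combination this
    | succ j ih =>
      intro u hu
      have hD := Dx_congr hV (f := ∑ k ∈ Finset.range (j + 2), (-1 : ℂ) ^ k • Dx^[k] (R (k - j)))
        (g := ((-1 : ℂ) ^ j * s) • (ofPt theta10 * Dx^[j] (velF δ))) ih u hu
      have hpoly : ∀ k ∈ Finset.range (j + 2),
          IsDiffPoly V ((-1 : ℂ) ^ k • Dx^[k] (R (k - j))) := fun k hk =>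
        ((hRpoly _ (by have := Finset.mem_range.1 hk; omega)).Dx_iterate hV k).smul _
      rw [Dx_sum hV _ hpoly hu, Dx_smul, Pi.smul_apply, smul_eq_mul, Dx_mul hV hth (hb j) hu,
        ← Function.iterate_succ_apply' Dx] at hD
      rw [Finset.sum_range_succ', Pi.add_apply, Finset.sum_apply]
      have e1 : ∀ k ∈ Finset.range (j + 2),
          ((-1 : ℂ) ^ (k + 1) • Dx^[k + 1] (R ((k + 1 : ℕ) - (j + 1 : ℕ)))) u
            = -Dx ((-1 : ℂ) ^ k • Dx^[k] (R (k - j))) u := by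
        intro k _
        have e : ((k + 1 : ℕ) - (j + 1 : ℕ) : ℤ) = k - j := by push_cast; ring
        rw [e, Function.iterate_succ_apply', Dx_smul]
        simp [pow_succ]
      have e2 : ((0 : ℕ) - (j + 1 : ℕ) : ℤ) = -1 - j := by push_cast; ring
      rw [Finset.sum_congr rfl e1, Finset.sum_neg_distrib, hD, e2, hRneg]
      simp only [pow_zero, Function.iterate_zero, id_eq, Pi.smul_apply, Pi.mul_apply,
        smul_eq_mul, hN u hu, ofPt]
      ring
  obtain ⟨j, rfl⟩ : ∃ j : ℕ, k = -1 - j := ⟨(-1 - k).toNat, by omega⟩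
  rw [Phi_apply _ _ _ _ (j + 2) fun γ i hi => firstOrder_comp_linOpAdj_of_gt g h γ δ (by
    push_cast at hi; omega)]
  have e : ∀ k : ℕ, (-1 - j + 1 + k : ℤ) = k - j := fun k => by ring
  simp only [e, firstOrder_comp_linOpAdj_neg]
  have hSu := hS j u hu
  simp only [hRdef] at hSu
  rw [Pi.sub_apply, Pi.mul_apply, hSu, Finset.sum_apply]
  have e3 : ∑ γ, (ofPt (pd γ fun v => inv v α) *
        (-1 : ℂ) ^ j • (h γ (Fin.last (n + 1)) * Dx^[j] (velF δ))) u
      = (-1) ^ j * (s * velF α u) * Dx^[j] (velF δ) u := by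
    rw [← hA u hu, Finset.mul_sum, Finset.sum_mul]
    refine Finset.sum_congr rfl fun γ _ => ?_
    simp only [ofPt, Pi.mul_apply, Pi.smul_apply, smul_eq_mul]
    ring
  have hne : theta10 (u 0) ≠ 0 := by
    rw [theta10_eq]
    exact hVN _ hu
  rw [e3]
  simp only [Pi.mul_apply, ofPt]
  field_simp
  ring

end

/-! ### Operators of hydrodynamic type -/

section
variable {v : Pt n} {u : Jet n}

/-- The components `v̂^α_x` of the velocity in the inverted coordinates. -/
noncomputable def invVel (v X : Pt n) (α : Fin (n + 2)) : ℂ :=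
  (∑ β, scaledJac α β v * X β) / v (Fin.last (n + 1))

theorem velF_apply (hu : u 0 (Fin.last (n + 1)) ≠ 0) (δ : Fin (n + 2)) :
    velF δ u = invVel (u 0) (u 1) δ := by
  rw [velF, Dx_ofPt (analyticAt_inv hu δ), invVel, Finset.sum_div]
  exact Finset.sum_congr rfl fun β _ => by rw [pd_inv hu]; ring

theorem jacF_apply (hu : u 0 (Fin.last (n + 1)) ≠ 0) (β δ : Fin (n + 2)) :
    jacF β δ u = scaledJac δ β (u 0) := by
  simp only [jacF, ofPt, theta10_eq]
  exact mul_pd_inv hu δ β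

theorem isOpen_last_ne_zero : IsOpen {v : Pt n | v (Fin.last (n + 1)) ≠ 0} :=
  isOpen_ne_fun (continuous_apply _) continuous_const

theorem Dx_jacF (hu : u 0 (Fin.last (n + 1)) ≠ 0) (β δ : Fin (n + 2)) :
    Dx (jacF β δ) u = (if δ = 0 then u 1 (Fin.rev β) else 0)
      - if β = Fin.last (n + 1) then invVel (u 0) (u 1) δ else 0 := by
  have h := Dx_congr isOpen_last_ne_zero (f := jacF β δ) (g := ofPt (scaledJac δ β))
    (fun u hu => jacF_apply hu β δ) u hu
  rw [h, Dx_ofPt (analyticAt_scaledJac hu δ β)]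
  refine mul_left_cancel₀ hu ?_
  rw [Finset.mul_sum]
  have e : ∀ ν, u 0 (Fin.last (n + 1)) * (pd ν (scaledJac δ β) (u 0) * u 1 ν)
      = (if ν = Fin.rev β then (if δ = 0 then u 0 (Fin.last (n + 1)) * u 1 ν else 0) else 0)
        - (if β = Fin.last (n + 1) then scaledJac δ ν (u 0) * u 1 ν else 0) := by
    intro ν
    rw [← mul_assoc, pd_scaledJac hu]
    split_ifs <;> ring
  simp only [e, Finset.sum_sub_distrib, Finset.sum_ite_eq', Finset.mem_univ, if_true, invVel]
  split_ifs
  · field_simp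
  · field_simp; simp
  · field_simp; simp
  · simp

theorem Dx_coord (γ : Fin (n + 2)) : Dx (ofPt fun v : Pt n => id v γ) = fun u => u 1 γ :=
  Dx_jet 0 γ

end

theorem HydroOp.toOp_eq (P : HydroOp n) : P.toOp = firstOrder
    (fun α β => ofPt fun v => P.g α β v * 1⁻¹)
    (fun α β => ∑ γ, ofPt (fun v => P.Γ α β γ v * 1⁻¹) * Dx (ofPt fun v : Pt n => id v γ)) :=
  rfl

theorem HydroOp.hat_one (P : HydroOp n) (α β : Fin (n + 2)) (u : Jet n) :
    (P.hat α β).1 1 u = P.g α β (inv (u 0)) * (u 0 (Fin.last (n + 1)))⁻¹ := by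
  simp [HydroOp.hat, HydroOp.inVars, add_coe_apply, mono_apply, ofPt, theta10_eq]

theorem HydroOp.hat_zero (P : HydroOp n) (α β : Fin (n + 2)) {u : Jet n}
    (hu : u 0 (Fin.last (n + 1)) ≠ 0) :
    (P.hat α β).1 0 u = ∑ γ, P.Γ α β γ (inv (u 0)) * (u 0 (Fin.last (n + 1)))⁻¹
      * invVel (u 0) (u 1) γ := by
  simp only [HydroOp.hat, HydroOp.inVars, add_coe_apply, mono_apply, theta10_eq, if_true,
    zero_ne_one, if_false, zero_add, Finset.sum_apply, Pi.mul_apply]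
  exact Finset.sum_congr rfl fun γ _ => by rw [← velF_apply hu]; rfl

theorem HydroOp.hat_of_ne (P : HydroOp n) (α β : Fin (n + 2)) {k : ℤ} (h1 : k ≠ 1) (h0 : k ≠ 0) :
    (P.hat α β).1 k = 0 := by
  simp [HydroOp.hat, HydroOp.inVars, add_coe_apply, mono_apply, h1, h0]

/-- Pointwise conditions under which the reciprocal transformation takes the operator of
hydrodynamic type `P` to the operator of hydrodynamic type `Ph`; `X` stands for `v_x`.  The hypotheses `h1` and `h0` compare the coefficients
of order one and zero, while `hs` and `hR` make those of negative order vanish. -/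
theorem Phi_toOp_eqOn {P Ph : HydroOp n} {V : Set (Pt n)} (hV : IsOpen V)
    (hVN : ∀ v ∈ V, v (Fin.last (n + 1)) ≠ 0)
    (hg : ∀ β, ∀ v ∈ V, AnalyticAt ℂ (P.g (Fin.last (n + 1)) β) v)
    (hΓ : ∀ β γ, ∀ v ∈ V, AnalyticAt ℂ (P.Γ (Fin.last (n + 1)) β γ) v)
    (h1 : ∀ v ∈ V, ∀ α δ, ∑ γ, scaledJac α γ v * ∑ β, P.g γ β v * scaledJac δ β v
      = Ph.g α δ (inv v))
    (h0 : ∀ v ∈ V, ∀ X : Pt n, ∀ α δ,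
      ∑ γ, scaledJac α γ v * ∑ β, ((if δ = 0 then P.g γ β v * X (Fin.rev β) else 0)
          + (∑ ε, P.Γ γ β ε v * X ε) * scaledJac δ β v)
        - invVel v X α * ∑ β, P.g (Fin.last (n + 1)) β v * scaledJac δ β v
      = ∑ ε, Ph.Γ α δ ε (inv v) * invVel v X ε)
    (s : ℂ)
    (hs : ∀ v ∈ V, ∀ X : Pt n, ∀ γ, ∑ ε, P.Γ γ (Fin.last (n + 1)) ε v * X ε = s * X γ)
    (hR : ∀ v ∈ V, ∀ X : Pt n, ∀ δ,
      ∑ β, (∑ ε, P.Γ (Fin.last (n + 1)) β ε v * X ε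
          - ∑ ε, pd ε (P.g (Fin.last (n + 1)) β) v * X ε) * scaledJac δ β v
        + P.g (Fin.last (n + 1)) (Fin.last (n + 1)) v * invVel v X δ
      = s * (v (Fin.last (n + 1)) * invVel v X δ)) :
    (Phi P.toOp).EqOn Ph.hat V := by
  intro α δ k u hu
  have hN := hVN _ hu
  have hgv : ∀ α β (u : Jet n), ofPt (fun v => P.g α β v * 1⁻¹) u = P.g α β (u 0) := by
    intro α β u
    simp [ofPt]
  have hhv : ∀ α β (u : Jet n), (∑ γ, ofPt (fun v => P.Γ α β γ v * 1⁻¹)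
      * Dx (ofPt fun v : Pt n => id v γ)) u = ∑ γ, P.Γ α β γ (u 0) * u 1 γ := by
    intro α β u
    simp only [Dx_coord]
    simp [ofPt, Finset.sum_apply]
  have hpd : ∀ γ, pd γ (fun v => inv v α) (u 0) = scaledJac α γ (u 0) / u 0 (Fin.last (n + 1)) :=
    fun γ => pd_inv hN α γ
  rw [HydroOp.toOp_eq]
  rcases lt_trichotomy k 0 with hk | rfl | hk
  · rw [HydroOp.hat_of_ne _ _ _ (by omega) hk.ne]
    refine Phi_firstOrder_neg hV hVN ?_ ?_ s α δ ?_ ?_ ?_ k hk u hu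
    · intro β
      exact IsDiffPoly.ofPt fun v hv => (hg β v hv).fun_mul analyticAt_const
    · intro β
      refine IsDiffPoly.sum _ fun γ _ => ?_
      rw [Dx_coord]
      exact (IsDiffPoly.ofPt fun v hv => (hΓ β γ v hv).fun_mul analyticAt_const).mul
        (IsDiffPoly.jet 1 γ)
    · intro u hu
      have hN := hVN _ hu
      have hgp : ∀ β, IsDiffPoly V (ofPt (P.g (Fin.last (n + 1)) β)) := fun β =>
        IsDiffPoly.ofPt (hg β)
      have hjp : ∀ β, IsDiffPoly V (jacF β δ) := fun β =>
        IsDiffPoly.congr (IsDiffPoly.ofPt (f := scaledJac δ β)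
          fun v hv => analyticAt_scaledJac (hVN v hv) δ β)
          fun u hu => (jacF_apply (hVN _ hu) β δ).symm
      have e1 : (fun v => P.g (Fin.last (n + 1)) (Fin.last (n + 1)) v * 1⁻¹)
          = P.g (Fin.last (n + 1)) (Fin.last (n + 1)) := by funext v; simp
      have e2 : ∀ β, (ofPt fun v => P.g (Fin.last (n + 1)) β v * 1⁻¹)
          = ofPt (P.g (Fin.last (n + 1)) β) := fun β => by funext v; simp [ofPt]
      rw [firstOrder_comp_linOpAdj_zero, firstOrder_comp_linOpAdj_one]
      simp only [e2]
      rw [Dx_sum hV _ (fun β _ => (hgp β).mul (hjp β)) hu, theta10_eq]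
      dsimp only
      rw [velF_apply hN, ← hR _ hu (u 1) δ]
      simp only [Pi.add_apply, Finset.sum_apply, Pi.mul_apply, jacF_apply hN, velF_apply hN,
        Dx_mul hV (hgp _) (hjp _) hu, Dx_ofPt (hg _ _ hu), sub_mul, Finset.sum_add_distrib,
        Finset.sum_sub_distrib]
      simp only [ofPt, Dx_coord, inv_one, mul_one]
      ring
    · intro u hu
      rw [hhv, hs _ hu, theta10_eq]
      congr 1
      exact (congrFun (Dx_coord (Fin.last (n + 1))) u).symm
    · intro u hu
      have hN := hVN _ hu
      simp only [hhv, hs _ hu, velF_apply hN, invVel, pd_inv hN]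
      rw [Finset.sum_div, Finset.mul_sum]
      exact Finset.sum_congr rfl fun γ _ => by ring
  · rw [HydroOp.hat_zero _ _ _ hN, Phi_firstOrder_zero]
    have hR : ∑ ε, Ph.Γ α δ ε (inv (u 0)) * (u 0 (Fin.last (n + 1)))⁻¹ * invVel (u 0) (u 1) ε
        = (u 0 (Fin.last (n + 1)))⁻¹ * ∑ ε, Ph.Γ α δ ε (inv (u 0)) * invVel (u 0) (u 1) ε := by
      rw [Finset.mul_sum]
      exact Finset.sum_congr rfl fun _ _ => by ring
    -- the contribution of the column `N` of the Jacobian matrix to `∂_x (ρ ∂v̂/∂v)` is cancelled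
    -- by that of the nonlocal term of `L*`
    have hsum : ∀ γ, ∑ β, (P.g γ β (u 0) * ((if δ = 0 then u 1 (Fin.rev β) else 0)
          - if β = Fin.last (n + 1) then invVel (u 0) (u 1) δ else 0)
          + (∑ ε, P.Γ γ β ε (u 0) * u 1 ε) * scaledJac δ β (u 0))
          + P.g γ (Fin.last (n + 1)) (u 0) * invVel (u 0) (u 1) δ
        = ∑ β, ((if δ = 0 then P.g γ β (u 0) * u 1 (Fin.rev β) else 0)
          + (∑ ε, P.Γ γ β ε (u 0) * u 1 ε) * scaledJac δ β (u 0)) := by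
      intro γ
      simp only [mul_sub, mul_ite, mul_zero, Finset.sum_add_distrib, Finset.sum_sub_distrib,
        Finset.sum_ite_eq', Finset.mem_univ, if_true]
      ring
    rw [hR, ← h0 _ hu, mul_sub, Pi.sub_apply, Finset.sum_apply]
    simp only [Pi.mul_apply, Pi.add_apply]
    congr 1
    · rw [Finset.mul_sum]
      refine Finset.sum_congr rfl fun γ _ => ?_
      rw [Finset.sum_apply]
      simp only [Pi.mul_apply, Pi.add_apply, hgv, hhv, jacF_apply hN, Dx_jacF hN, velF_apply hN,
        hsum]
      simp only [ofPt, hpd]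
      ring
    · rw [Finset.sum_apply]
      simp only [Pi.mul_apply, hgv, jacF_apply hN, velF_apply hN]
      simp only [ofPt, theta10_eq]
      ring
  · by_cases hk1 : k = 1
    · subst hk1
      rw [HydroOp.hat_one, Phi_firstOrder_one, ← h1 _ hu, Finset.sum_mul, Finset.sum_apply]
      refine Finset.sum_congr rfl fun γ _ => ?_
      rw [Pi.mul_apply, Finset.sum_apply]
      simp only [Pi.mul_apply, hgv, jacF_apply hN]
      simp only [ofPt, hpd]
      ring
    · rw [HydroOp.hat_of_ne _ _ _ hk1 hk.ne', Phi_firstOrder_of_gt _ _ _ _ (by omega)]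

theorem isLocalOn_of_eqOn_hat {Q : MatOp n} {P : HydroOp n} {V : Set (Pt n)}
    (h : Q.EqOn P.hat V) : Q.IsLocalOn V := by
  intro α β k hk u hu
  rw [h α β k u hu, HydroOp.hat_of_ne _ _ _ (by omega) hk.ne]
  rfl

/-! ### The two Hamiltonian structures -/

theorem sum_scaledJac_mul_eq_invVel {v : Pt n} (hv : v (Fin.last (n + 1)) ≠ 0) (X : Pt n)
    (δ : Fin (n + 2)) : ∑ β, scaledJac δ β v * X β = v (Fin.last (n + 1)) * invVel v X δ := by
  rw [invVel]
  field_simp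

theorem Phi_P1_eqOn {V : Set (Pt n)} (hV : IsOpen V) (hVN : ∀ v ∈ V, v (Fin.last (n + 1)) ≠ 0) :
    (Phi (P1 n).toOp).EqOn (P1 n).hat V := by
  have h0N : (0 : Fin (n + 2)) ≠ Fin.last (n + 1) := Fin.last_pos.ne
  have hg : ∀ (x : Fin (n + 2) → ℂ) γ, ∑ β, eta γ β * x β = x (Fin.rev γ) :=
    fun x γ => sum_eta_mul γ x
  refine Phi_toOp_eqOn hV hVN (fun β v _ => analyticAt_const) (fun β γ v _ => analyticAt_const)
    ?_ ?_ 0 ?_ ?_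
  · intro v hv α δ
    simp only [P1, hg]
    rw [sum_scaledJac_mul_scaledJac_rev (hVN v hv)]
    rfl
  · intro v hv X α δ
    simp only [P1, hg, zero_mul, Finset.sum_const_zero, add_zero]
    rw [Fin.rev_last, scaledJac_zero_right]
    by_cases hδ : δ = 0
    · simp only [hδ, if_true, hg (fun β => X (Fin.rev β)), Fin.rev_rev]
      rw [sum_scaledJac_mul_eq_invVel (hVN v hv)]
      ring
    · simp [hδ]
  · intro v hv X γ
    simp [P1]
  · intro v hv X δ
    have hp : ∀ ε β, pd ε ((P1 n).g (Fin.last (n + 1)) β) v = 0 := fun ε β => pd_const ε _ v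
    simp only [hp]
    simp [P1, eta, h0N.symm]

section
variable {F Fh : Pt n → ℂ} {U : Set (Pt n)} {d : ℂ} {μ : Fin (n + 2) → ℂ}

theorem IsSolution.cUp_last_right (hF : IsSolution F U) {v : Pt n} (hv : v ∈ U)
    (γ ε : Fin (n + 2)) : cUp F γ (Fin.last (n + 1)) ε v = if ε = γ then 1 else 0 := by
  rw [cUp_eq, Fin.rev_last, hF.metric v hv, eta, Fin.rev_rev]

theorem IsSolution.cUp_last_left (hF : IsSolution F U) {v : Pt n} (hv : v ∈ U)
    (β ε : Fin (n + 2)) : cUp F (Fin.last (n + 1)) β ε v = if ε = β then 1 else 0 := by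
  rw [cUp_eq, Fin.rev_last, hF.cLow_zero_mid hv, Fin.rev_rev]

/-- `c^{γβ}_ε Y_β Z^ε`, where the index of `Y` is lowered with `η`, is symmetric in `Y` and `Z`. -/
theorem IsSolution.sum_cUp_comm (hF : IsSolution F U) {v : Pt n} (hv : v ∈ U) (Y Z : Pt n)
    (γ : Fin (n + 2)) : ∑ β, Y (Fin.rev β) * ∑ ε, cUp F γ β ε v * Z ε
      = ∑ β, Z (Fin.rev β) * ∑ ε, cUp F γ β ε v * Y ε := by
  have h : ∀ Y Z : Pt n, ∑ β, Y (Fin.rev β) * ∑ ε, cUp F γ β ε v * Z ε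
      = ∑ β, ∑ ε, cLow F β (Fin.rev γ) ε v * Y β * Z ε := by
    intro Y Z
    rw [← Equiv.sum_comp Fin.revPerm]
    refine Finset.sum_congr rfl fun β _ => ?_
    simp only [Fin.revPerm_apply, Fin.rev_rev, cUp_eq, Finset.mul_sum]
    exact Finset.sum_congr rfl fun ε _ => by ring
  rw [h, h, Finset.sum_comm]
  refine Finset.sum_congr rfl fun β _ => Finset.sum_congr rfl fun ε _ => ?_
  have e : cLow F ε (Fin.rev γ) β v = cLow F β (Fin.rev γ) ε v := by
    rw [cLow_swap_left (hF.analytic v hv), cLow_swap_right hF.isOpen hF.analytic hv,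
      cLow_swap_left (hF.analytic v hv), cLow_swap_left (hF.analytic v hv) β,
      cLow_swap_right hF.isOpen hF.analytic hv]
  rw [e]
  ring

/-- The transformation law of the structure constants, contracted with a vector `Z`. -/
theorem sum_scaledJac_mul_cUp (hF : IsSolution F U) (hinv : IsInversion F Fh U)
    (hFh : IsSolution Fh (inv '' regular U)) {v : Pt n} (hv : v ∈ regular U) (Z : Pt n)
    (α δ : Fin (n + 2)) :
    ∑ γ, scaledJac α γ v * ∑ β, (∑ ε, cUp F γ β ε v * Z ε) * scaledJac δ β v
      = ∑ ζ, cUp Fh α δ ζ (inv v) * invVel v Z ζ := by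
  refine mul_left_cancel₀ hv.2 ?_
  have h1 : v (Fin.last (n + 1)) * ∑ ζ, cUp Fh α δ ζ (inv v) * invVel v Z ζ
      = ∑ ε, Z ε * ∑ ζ, cUp Fh α δ ζ (inv v) * scaledJac ζ ε v := by
    have h : ∀ ζ, v (Fin.last (n + 1)) * (cUp Fh α δ ζ (inv v) * invVel v Z ζ)
        = ∑ ε, Z ε * (cUp Fh α δ ζ (inv v) * scaledJac ζ ε v) := by
      intro ζ
      rw [mul_left_comm, ← sum_scaledJac_mul_eq_invVel hv.2, Finset.mul_sum]
      exact Finset.sum_congr rfl fun _ _ => by ring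
    simp only [Finset.mul_sum, h]
    exact Finset.sum_comm
  have h2 : ∑ γ, scaledJac α γ v * ∑ β, (∑ ε, cUp F γ β ε v * Z ε) * scaledJac δ β v
      = ∑ ε, Z ε * ∑ γ, ∑ β, scaledJac α γ v * scaledJac δ β v * cUp F γ β ε v := by
    simp only [Finset.mul_sum, Finset.sum_mul]
    rw [Finset.sum_comm (s := Finset.univ (α := Fin (n + 2))) (f := fun ε γ => ∑ β, Z ε *
      (scaledJac α γ v * scaledJac δ β v * cUp F γ β ε v))]
    refine Finset.sum_congr rfl fun γ _ => ?_
    rw [Finset.sum_comm]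
    exact Finset.sum_congr rfl fun _ _ => Finset.sum_congr rfl fun _ _ => by ring
  rw [h1, h2, Finset.mul_sum]
  refine Finset.sum_congr rfl fun ε _ => ?_
  rw [mul_left_comm, sum_cUp_mul_scaledJac hF hinv hFh α δ ε v hv]

theorem Phi_P2_eqOn (hF : IsSolution F U) (hU : U.Nonempty) (hconf : IsConformal F U d μ)
    (hinv : IsInversion F Fh U) (hFh : IsSolution Fh (inv '' regular U)) :
    (Phi (P2 F d μ).toOp).EqOn (P2 Fh (chargeInv d) (spectrumInv μ)).hat (regular U) := by
  have h0N : (0 : Fin (n + 2)) ≠ Fin.last (n + 1) := Fin.last_pos.ne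
  have hV := isOpen_regular hF.isOpen
  have hN := hconf.spectrum_last hF hU
  -- the row `N` of the metric consists of the components of the Euler vector field
  have hgN : ∀ v ∈ U, ∀ β, (P2 F d μ).g (Fin.last (n + 1)) β v = (1 - d / 2 - μ β) * v β := by
    intro v hv β
    simp [P2, hF.cUp_last_left hv]
  have hcU : ∀ v ∈ U, ∀ α β γ, AnalyticAt ℂ (cUp F α β γ) v := by
    intro v hv α β γ
    rw [cUp_eq]
    exact analyticAt_cLow (hF.analytic v hv) _ _ _
  refine Phi_toOp_eqOn hV (fun v hv => hv.2) ?_ ?_ ?_ ?_ (1 / 2 - d / 2) ?_ ?_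
  · intro β v hv
    exact analyticAt_euler (q := fun γ => 1 - d / 2 - μ γ)
      (φ := fun γ => cUp F (Fin.last (n + 1)) β γ) fun γ => hcU v hv.1 _ _ _
  · intro β γ v hv
    exact analyticAt_const.fun_mul (hcU v hv.1 _ _ _)
  · intro v hv α δ
    have h := sum_scaledJac_mul_cUp hF hinv hFh hv (fun γ => (1 - d / 2 - μ γ) * v γ) α δ
    have hE : ∀ ζ, invVel v (fun γ => (1 - d / 2 - μ γ) * v γ) ζ
        = (1 - chargeInv d / 2 - spectrumInv μ ζ) * inv v ζ := by
      intro ζ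
      refine mul_left_cancel₀ hv.2 ?_
      rw [← sum_scaledJac_mul_eq_invVel hv.2, hconf.sum_scaledJac_mul_euler hF hU hv.2]
    simp only [hE] at h
    simp only [P2]
    simp only [mul_comm _ (cUp _ _ _ _ _)]
    exact h
  · intro v hv X α δ
    have hR : ∑ ε, (P2 Fh (chargeInv d) (spectrumInv μ)).Γ α δ ε (inv v) * invVel v X ε
        = (1 / 2 - spectrumInv μ δ) * ∑ γ, scaledJac α γ v *
          ∑ β, (∑ ε, cUp F γ β ε v * X ε) * scaledJac δ β v := by
      rw [sum_scaledJac_mul_cUp hF hinv hFh hv, Finset.mul_sum]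
      exact Finset.sum_congr rfl fun _ _ => mul_assoc _ _ _
    have hE : ∑ β, (P2 F d μ).g (Fin.last (n + 1)) β v * scaledJac δ β v
        = v (Fin.last (n + 1)) * ((1 - chargeInv d / 2 - spectrumInv μ δ) * inv v δ) := by
      rw [← hconf.sum_scaledJac_mul_euler hF hU hv.2]
      exact Finset.sum_congr rfl fun β _ => by rw [hgN v hv.1, mul_comm]
    have hγ : ∀ γ, ∑ β, ((if δ = 0 then (P2 F d μ).g γ β v * X (Fin.rev β) else 0)
          + (∑ ε, (P2 F d μ).Γ γ β ε v * X ε) * scaledJac δ β v)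
        = (1 / 2 - spectrumInv μ δ) * ∑ β, (∑ ε, cUp F γ β ε v * X ε) * scaledJac δ β v
          + (1 - chargeInv d / 2 - spectrumInv μ δ) * inv v δ * X γ := by
      intro γ
      have h1 := sum_scaledJac_mul δ v
        fun β => (spectrumInv μ δ - μ β) * ∑ ε, cUp F γ β ε v * X ε
      have hT : ∑ ε, cUp F γ (Fin.last (n + 1)) ε v * X ε = X γ := by
        simp [hF.cUp_last_right hv.1]
      have h2 : ∑ β, (∑ ε, (P2 F d μ).Γ γ β ε v * X ε) * scaledJac δ β v
          = (1 / 2 - spectrumInv μ δ) * (∑ β, (∑ ε, cUp F γ β ε v * X ε) * scaledJac δ β v)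
            + ∑ β, scaledJac δ β v
              * ((spectrumInv μ δ - μ β) * ∑ ε, cUp F γ β ε v * X ε) := by
        rw [Finset.mul_sum, ← Finset.sum_add_distrib]
        refine Finset.sum_congr rfl fun β _ => ?_
        have e : ∑ ε, (P2 F d μ).Γ γ β ε v * X ε
            = (1 / 2 - μ β) * ∑ ε, cUp F γ β ε v * X ε := by
          rw [Finset.mul_sum]
          exact Finset.sum_congr rfl fun _ _ => mul_assoc _ _ _
        rw [e]
        ring
      -- for `δ = 1` the terms linear in `v` cancel by the symmetry of the structure constants
      have h3 : (∑ β, if δ = 0 then (P2 F d μ).g γ β v * X (Fin.rev β) else 0)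
          + (if δ = 0 then ∑ β, v (Fin.rev β)
            * ((spectrumInv μ δ - μ β) * ∑ ε, cUp F γ β ε v * X ε) else 0) = 0 := by
        by_cases hδ : δ = 0
        · have h4 := hF.sum_cUp_comm hv.1 X (fun γ => (1 - d / 2 - μ γ) * v γ) γ
          have h5 : ∀ β, (P2 F d μ).g γ β v * X (Fin.rev β)
              = X (Fin.rev β) * ∑ ε, cUp F γ β ε v * ((1 - d / 2 - μ ε) * v ε) := by
            intro β
            rw [mul_comm]
            simp only [P2]
            exact congrArg _ (Finset.sum_congr rfl fun ε _ => mul_comm _ (cUp F γ β ε v))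
          simp only [hδ, if_true, h5]
          rw [h4, ← Finset.sum_add_distrib]
          refine Finset.sum_eq_zero fun β _ => ?_
          have h6 := hconf.spectrum_add_rev hF hU β
          have h7 : spectrumInv μ 0 = d / 2 - 1 := by simp [spectrumInv, hN]
          rw [h7]
          linear_combination (-v (Fin.rev β) * ∑ ε, cUp F γ β ε v * X ε) * h6
        · simp [hδ]
      have h8 : (if δ ≠ 0 ∧ δ ≠ Fin.last (n + 1) then
          (spectrumInv μ δ - μ δ) * ∑ ε, cUp F γ δ ε v * X ε else 0) = 0 := by
        split_ifs with h
        · simp [spectrumInv, h.1, h.2]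
        · rfl
      rw [hT, h8, hN] at h1
      rw [Finset.sum_add_distrib, h2, h1]
      simp only [chargeInv]
      linear_combination h3
    rw [hR, hE]
    simp only [hγ, mul_add, Finset.sum_add_distrib]
    have h9 : ∑ γ, scaledJac α γ v
          * ((1 - chargeInv d / 2 - spectrumInv μ δ) * inv v δ * X γ)
        = (1 - chargeInv d / 2 - spectrumInv μ δ) * inv v δ
          * ∑ γ, scaledJac α γ v * X γ := by
      rw [Finset.mul_sum]
      exact Finset.sum_congr rfl fun _ _ => by ring
    have h10 : ∑ γ, scaledJac α γ v * ((1 / 2 - spectrumInv μ δ)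
          * ∑ β, (∑ ε, cUp F γ β ε v * X ε) * scaledJac δ β v)
        = (1 / 2 - spectrumInv μ δ) * ∑ γ, scaledJac α γ v
          * ∑ β, (∑ ε, cUp F γ β ε v * X ε) * scaledJac δ β v := by
      rw [Finset.mul_sum]
      exact Finset.sum_congr rfl fun _ _ => mul_left_comm _ _ _
    rw [h9, h10, sum_scaledJac_mul_eq_invVel hv.2 X]
    ring
  · intro v hv X γ
    simp [P2, hF.cUp_last_right hv.1, hN]
  · intro v hv X δ
    have h1 : ∀ β, ∑ ε, pd ε ((P2 F d μ).g (Fin.last (n + 1)) β) v * X ε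
        = (1 - d / 2 - μ β) * X β := by
      intro β
      have e : ∀ ε, pd ε ((P2 F d μ).g (Fin.last (n + 1)) β) v
          = (1 - d / 2 - μ β) * if ε = β then 1 else 0 := fun ε => by
        rw [pd_congr hF.isOpen (fun v hv => hgN v hv β) ε v hv.1, pd_const_mul, pd_coord]
      simp [e]
    have h2 : ∀ β, ∑ ε, (P2 F d μ).Γ (Fin.last (n + 1)) β ε v * X ε = (1 / 2 - μ β) * X β := by
      intro β
      simp [P2, hF.cUp_last_left hv.1]
    have h3 : ∀ β, ((1 / 2 - μ β) * X β - (1 - d / 2 - μ β) * X β) * scaledJac δ β v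
        = (d / 2 - 1 / 2) * (scaledJac δ β v * X β) := fun β => by ring
    simp only [h1, h2, h3, hgN v hv.1, ← Finset.mul_sum]
    rw [sum_scaledJac_mul_eq_invVel hv.2, hN]
    ring

end

end WDVV

theorem mainTheorem4 (n : ℕ) (U : Set (WDVV.Pt n)) (hU : U.Nonempty)
    (F Fh : WDVV.Pt n → ℂ) (d : ℂ) (μ : Fin (n + 2) → ℂ)
    (hF : WDVV.IsSolution F U) (hconf : WDVV.IsConformal F U d μ)
    (hinv : WDVV.IsInversion F Fh U)
    (hFh : WDVV.IsSolution Fh (WDVV.inv '' WDVV.regular U)) :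
    -- the inverted solution is conformal, with the charge and the spectrum that enter `P̂₂`
    WDVV.IsConformal Fh (WDVV.inv '' WDVV.regular U) (WDVV.chargeInv d) (WDVV.spectrumInv μ) ∧
    -- `Φ(P₁) = P̂₁`
    (WDVV.Phi (WDVV.P1 n).toOp).EqOn (WDVV.P1 n).hat (WDVV.regular U) ∧
    -- `Φ(P₂) = P̂₂`
    (WDVV.Phi (WDVV.P2 F d μ).toOp).EqOn
      (WDVV.P2 Fh (WDVV.chargeInv d) (WDVV.spectrumInv μ)).hat (WDVV.regular U) ∧
    -- in particular the transformed operators are local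
    (WDVV.Phi (WDVV.P1 n).toOp).IsLocalOn (WDVV.regular U) ∧
    (WDVV.Phi (WDVV.P2 F d μ).toOp).IsLocalOn (WDVV.regular U) := by
  have hV := WDVV.isOpen_regular hF.isOpen
  have h1 := WDVV.Phi_P1_eqOn hV fun v hv => hv.2
  have h2 := WDVV.Phi_P2_eqOn hF hU hconf hinv hFh
  exact ⟨hconf.inversion hF hU hinv hFh, h1, h2, WDVV.isLocalOn_of_eqOn_hat h1,
    WDVV.isLocalOn_of_eqOn_hat h2⟩
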